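/- Consider players $N=\{0,\dots,n-1\}$. Each player $i$ has disjoint sets $N_i^+$ (friends) and $N_i^-$ (enemies) of other players, with $|N_i^+\cup N_i^-|\le d$ for a constant $d>0$, and a total preorder $\unrhd_i$ on each of the two sets; all remaining players are neutral. A ballot $\langle\, \cdot\mid i\mid\cdot\,\rangle$ ranks the players listed before $i$ above $i$, and those listed after $i$ below $i$. For a coalition $C\ni i$ put $$\unrhd_i^+=\langle \unrhd_i(N_i^+)\mid i\mid\ \rangle,\quad C_i^+=\langle \unrhd_i(C\cap N_i^+)\mid i\mid \overleftarrow{\unrhd_i}(N_i^+\setminus C)\rangle,$$ $$\unrhd_i^-=\langle\ \mid i\mid \unrhd_i(N_i^-)\rangle,\quad C_i^-=\langle \overleftarrow{\unrhd_i}(C\cap N_i^-)\mid i\mid \unrhd_i(N_i^-\setminus C)\rangle,$$ where the arrow denotes the reversed order. For strict linear orders let $\tau(\alpha,\beta)$ be the number of pairs $(x,y)$ with $x$ above $y$ in $\alpha$ and $y$ above $x$ in $\beta$; for total preorders let $\overrightarrow{\tau}(\pi,\sigma)=\max_{\beta}\min_{\alpha}\tau(\alpha,\beta)$, where $\alpha$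 and $\beta$ range over the strict linear orders obtained from $\pi$ and $\sigma$, respectively, by resolving all indifferences. Let $\delta_i(C)=\overrightarrow{\tau}(\unrhd_i^+,C_i^+)+\overrightarrow{\tau}(\unrhd_i^-,C_i^-)$. Player $i$ weakly prefers $A\ni i$ to $B\ni i$ iff $\delta_i(A)\le\delta_i(B)$. This is a hedonic game with distance-based preference extension and degree bound $d$. A coalition structure (partition of $N$) $\Gamma$ is perfect if every player $i$ weakly prefers the coalition $\Gamma(i)$ of $\Gamma$ that contains $i$ to every $C\subseteq N$ with $i\in C$. A game is given as the sequence consisting of $n$ and, for every player in turn, the lists of friends and of enemies, each list preceded by its length and given in any order, every entry followed by a number below $n$ (smaller number: more preferred; equal numbers: indifferent). A coalition structure is given by listing, for every player in turn, the name (a number below $n$) of the player's coalition, different coalitions having different names. Running time is the number of instructions executed by a random access machine (constants, copying, addition, truncated subtraction, indirect load and store, jumps, comparisons) at unit cost, with words of $\log_2 n+O(1)$ bits. **Proposition.** Let $d>0$ be constant. 1. There is an algorithm that, given such a game with degree bound $d$ and a coalition structure $\Gamma$, decides in $O(n)$ time whether $\Gamma$ is perfect. 2. There is an algorithm that, given such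 a game with degree bound $d$, decides in $O(n)$ time whether the game admits a perfect coalition structure. In both parts one algorithm works for all $d$, and the constants in $O(n)$ and in the word length depend only on $d$. -/

import Mathlib

/-! ### Orders, resolutions of indifferences, directed Hausdorff-Kendall-tau distance -/

/-- The Kendall-tau distance of two strict linear orders: the number of ordered pairs `(x, y)`
with `x` above `y` in the first order and `y` above `x` in the second one. -/
noncomputable def kendallTau {A : Type} (s t : A → A → Prop) : ℕ :=
  Set.ncard {p : A × A | s p.1 p.2 ∧ t p.2 p.1}

/-- `s` is one of the strict linear orders represented by the weak order `r`: it contains the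
strict part of `r` and resolves every indifference in one of the two ways. -/
def Resolves {A : Type} (r s : A → A → Prop) : Prop :=
  IsStrictTotalOrder A s ∧ ∀ x y, r x y → ¬ r y x → s x y

/-- The directed Hausdorff-Kendall-tau distance
`max_{b resolving r₂} min_{a resolving r₁} kendallTau a b`. It is used on finite types and for total
preorders, where the maximum and the minimum range over finite nonempty sets. -/
noncomputable def directedDist {A : Type} (r₁ r₂ : A → A → Prop) : ℕ :=
  ⨆ b : {s : A → A → Prop // Resolves r₂ s}, ⨅ a : {s : A → A → Prop // Resolves r₁ s},
    kendallTau a.1 b.1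

/-- `r` (read: weakly preferred to) restricts to a total preorder on the set `S`. -/
def IsWeakOrderOn {A : Type} (S : Finset A) (r : A → A → Prop) : Prop :=
  (∀ x ∈ S, ∀ y ∈ S, r x y ∨ r y x) ∧
    ∀ x ∈ S, ∀ y ∈ S, ∀ z ∈ S, r x y → r y z → r x z

/-! ### Hedonic games with polarized ordinal preferences and distance-based extension -/

/-- The data of a game on the players `0, …, n - 1`: every player `i` has a set of friends and a
disjoint set of enemies, all different from `i`, with a weak order on either set
(`friendPref i j k`: `i` weakly prefers the friend `j` to the friend `k`). The remaining
players are neutral. -/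
structure HedonicGame (n : ℕ) where
  friends : Fin n → Finset (Fin n)
  enemies : Fin n → Finset (Fin n)
  friendPref : Fin n → Fin n → Fin n → Prop
  enemyPref : Fin n → Fin n → Fin n → Prop
  self_notMem_friends : ∀ i, i ∉ friends i
  self_notMem_enemies : ∀ i, i ∉ enemies i
  disjoint : ∀ i, Disjoint (friends i) (enemies i)
  friendPref_weak : ∀ i, IsWeakOrderOn (friends i) (friendPref i)
  enemyPref_weak : ∀ i, IsWeakOrderOn (enemies i) (enemyPref i)

namespace HedonicGame

variable {n : ℕ}

/-- Every player knows at most `d` other players. -/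
def DegreeLE (G : HedonicGame n) (d : ℕ) : Prop :=
  ∀ i, (G.friends i ∪ G.enemies i).card ≤ d

/-- The ballot `⟨ r(P) | i | r'(Q) ⟩`: the members of `P`, ordered by `r`, are above `i`, and the
members of `Q`, ordered by `r'`, are below `i`. -/
def ballot (i : Fin n) (P : Finset (Fin n)) (r : Fin n → Fin n → Prop)
    (Q : Finset (Fin n)) (r' : Fin n → Fin n → Prop) (x y : Fin n) : Prop :=
  (x ∈ P ∧ y ∈ P ∧ r x y) ∨ (x ∈ P ∧ y = i) ∨ (x ∈ P ∧ y ∈ Q) ∨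
    (x = i ∧ y = i) ∨ (x = i ∧ y ∈ Q) ∨ (x ∈ Q ∧ y ∈ Q ∧ r' x y)

/-- A relation on all players, restricted to the members of `S`. -/
def restrict (S : Finset (Fin n)) (r : Fin n → Fin n → Prop) (x y : {j // j ∈ S}) : Prop :=
  r x.1 y.1

/-- `i`'s opinion on the friends: all friends above `i`. -/
def prefPlus (G : HedonicGame n) (i : Fin n) : Fin n → Fin n → Prop :=
  ballot i (G.friends i) (G.friendPref i) ∅ (G.friendPref i)

/-- `i`'s opinion on the enemies: all enemies below `i`. -/
def prefMinus (G : HedonicGame n) (i : Fin n) : Fin n → Fin n → Prop :=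
  ballot i ∅ (G.enemyPref i) (G.enemies i) (G.enemyPref i)

/-- The coalition `C` seen by `i`, friends' part: present friends above `i` in `i`'s order,
absent friends below `i` in the reversed order. -/
def coalPlus (G : HedonicGame n) (i : Fin n) (C : Finset (Fin n)) : Fin n → Fin n → Prop :=
  ballot i (C ∩ G.friends i) (G.friendPref i)
    (G.friends i \ C) (fun x y => G.friendPref i y x)

/-- The coalition `C` seen by `i`, enemies' part: present enemies above `i` in the reversed order,
absent enemies below `i` in `i`'s order. -/
def coalMinus (G : HedonicGame n) (i : Fin n) (C : Finset (Fin n)) : Fin n → Fin n → Prop :=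
  ballot i (C ∩ G.enemies i) (fun x y => G.enemyPref i y x)
    (G.enemies i \ C) (G.enemyPref i)

/-- Distance on the friends' part, between orders on the friends of `i` and `i`. -/
noncomputable def deltaPlus (G : HedonicGame n) (i : Fin n) (C : Finset (Fin n)) : ℕ :=
  directedDist (restrict (insert i (G.friends i)) (G.prefPlus i))
    (restrict (insert i (G.friends i)) (G.coalPlus i C))

/-- Distance on the enemies' part, between orders on the enemies of `i` and `i`. -/
noncomputable def deltaMinus (G : HedonicGame n) (i : Fin n) (C : Finset (Fin n)) : ℕ :=
  directedDist (restrict (insert i (G.enemies i)) (G.prefMinus i))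
    (restrict (insert i (G.enemies i)) (G.coalMinus i C))

/-- The distance between `i`'s preference and the coalition `C`. -/
noncomputable def delta (G : HedonicGame n) (i : Fin n) (C : Finset (Fin n)) : ℕ :=
  G.deltaPlus i C + G.deltaMinus i C

/-- Player `i` weakly prefers the coalition `A` to the coalition `B`. -/
def WeaklyPrefers (G : HedonicGame n) (i : Fin n) (A B : Finset (Fin n)) : Prop :=
  G.delta i A ≤ G.delta i B

/-- A coalition structure is perfect if everybody is in one of their favourite coalitions. -/
def IsPerfect (G : HedonicGame n) (Γ : Finpartition (Finset.univ : Finset (Fin n))) : Prop :=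
  ∀ i, ∀ C : Finset (Fin n), i ∈ C → G.WeaklyPrefers i (Γ.part i) C

/-! ### Encoding of games and coalition structures as sequences of natural numbers -/

/-- `l` lists every member of `S` exactly once, in any order, each with a number below `n` such
that smaller numbers mean more preferred and equal numbers mean indifferent. -/
def ListsRanked (S : Finset (Fin n)) (r : Fin n → Fin n → Prop) (l : List (Fin n × ℕ)) : Prop :=
  (l.map Prod.fst).Nodup ∧ (∀ j, j ∈ l.map Prod.fst ↔ j ∈ S) ∧
    (∀ p ∈ l, p.2 < n) ∧ ∀ p ∈ l, ∀ q ∈ l, (r p.1 q.1 ↔ p.2 ≤ q.2)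

/-- A ranked list as numbers: its length, then every player followed by its rank. -/
def encodeRanked (l : List (Fin n × ℕ)) : List ℕ :=
  l.length :: l.flatMap fun p => [p.1.val, p.2]

/-- `u` encodes the game: the number of players, then for every player in turn the ranked list of
friends and the ranked list of enemies. -/
def Encodes (G : HedonicGame n) (u : List ℕ) : Prop :=
  ∃ F E : Fin n → List (Fin n × ℕ),
    (∀ i, ListsRanked (G.friends i) (G.friendPref i) (F i)) ∧
    (∀ i, ListsRanked (G.enemies i) (G.enemyPref i) (E i)) ∧
    u = n :: (List.finRange n).flatMap fun i => encodeRanked (F i) ++ encodeRanked (E i)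

/-- `v` encodes the coalition structure: for every player in turn the name of their coalition, where
the names of the coalitions are arbitrary distinct numbers below `n`. -/
def EncodesStructure (Γ : Finpartition (Finset.univ : Finset (Fin n))) (v : List ℕ) : Prop :=
  ∃ g : Fin n → Fin n, (∀ i j, g i = g j ↔ j ∈ Γ.part i) ∧
    v = (List.finRange n).map fun i => (g i).val

end HedonicGame

/-! ### Word random access machines with unit cost -/

namespace WordRAM

/-- Instructions. `r`, `s`, `t` are register numbers, `m` is a program line. -/
inductive Instr : Type
  /-- `r := k` -/
  | const (r k : ℕ)
  /-- `r := s` -/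
  | move (r s : ℕ)
  /-- `r := s + t` -/
  | add (r s t : ℕ)
  /-- `r := max (s - t) 0` -/
  | sub (r s t : ℕ)
  /-- `r := memory[s]` -/
  | load (r s : ℕ)
  /-- `memory[r] := s` -/
  | store (r s : ℕ)
  | jump (m : ℕ)
  /-- if `s < t` go to line `m`, otherwise to the next line -/
  | jumpLt (s t m : ℕ)
  /-- if `s = t` go to line `m`, otherwise to the next line -/
  | jumpEq (s t m : ℕ)
  /-- stop with a yes/no answer -/
  | halt (answer : Bool)

/-- A configuration: the program line, the registers and the memory cells. -/
structure Config : Type where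
  pc : ℕ
  reg : ℕ → ℕ
  mem : ℕ → ℕ

/-- Write `v` to register `r` and go to the next line. -/
def Config.setReg (c : Config) (r v : ℕ) : Config :=
  { pc := c.pc + 1, reg := Function.update c.reg r v, mem := c.mem }

/-- One step of the program `P`. All words have to stay below `W`: an instruction that would
produce a larger number gets stuck (`none`), as does a halting one or leaving the program. -/
def step (W : ℕ) (P : List Instr) (c : Config) : Option Config :=
  match P[c.pc]? with
  | some (.const r k) => if k < W then some (c.setReg r k) else none
  | some (.move r s) => some (c.setReg r (c.reg s))
  | some (.add r s t) =>
      if c.reg s + c.reg t < W then some (c.setReg r (c.reg s + c.reg t)) else none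
  | some (.sub r s t) => some (c.setReg r (c.reg s - c.reg t))
  | some (.load r s) => some (c.setReg r (c.mem (c.reg s)))
  | some (.store r s) =>
      some { c with pc := c.pc + 1, mem := Function.update c.mem (c.reg r) (c.reg s) }
  | some (.jump m) => some { c with pc := m }
  | some (.jumpLt s t m) =>
      some { c with pc := if c.reg s < c.reg t then m else c.pc + 1 }
  | some (.jumpEq s t m) =>
      some { c with pc := if c.reg s = c.reg t then m else c.pc + 1 }
  | some (.halt _) => none
  | none => none

/-- `Run W P c k b`: started in `c`, the program executes exactly `k` instructions, the last of
which halts with the answer `b`. -/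
inductive Run (W : ℕ) (P : List Instr) : Config → ℕ → Bool → Prop
  | halt {c : Config} {b : Bool} : P[c.pc]? = some (.halt b) → Run W P c 1 b
  | step {c c' : Config} {k : ℕ} {b : Bool} :
      step W P c = some c' → Run W P c' k b → Run W P c (k + 1) b

/-- The initial configuration: the input stands in the memory cells `0, 1, …`, its length in
register `0`, and everything else is `0`. -/
def init (x : List ℕ) : Config where
  pc := 0
  reg := fun r => if r = 0 then x.length else 0
  mem := fun a => x.getD a 0

/-- On the input `x`, which fits into words below `W`, the program stops with the answer `b` after
at most `T` steps, using only words below `W`. -/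
def AnswersWithin (P : List Instr) (x : List ℕ) (W T : ℕ) (b : Bool) : Prop :=
  x.length < W ∧ (∀ a ∈ x, a < W) ∧ ∃ k ≤ T, Run W P (init x) k b

end WordRAM

/-! Distances are natural numbers, and every player can reach distance zero. A coalition with all
friends and no enemy of `i` turns both coalition ballots into the opinions themselves. An absent
friend or a present enemy lies on opposite sides of `i` in opinion and ballot, which costs a pair in
every resolution. Since `i` together with the friends has distance zero, a structure is perfect iff
everybody is with all friends and no enemy (`isPerfect_iff`); the rankings play no further role.

Part 1 therefore only compares the names of the two players of every listed entry, and there are at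
most `d * n` entries. For part 2, a perfect structure keeps every connected component of the
undirected friendship graph in one coalition, so if any perfect structure exists, the components
themselves form one (`forall_fits_iff_exists_isPerfect`). The program labels the components by
breadth-first search and applies the test of part 1 to the labels.

The programs are written in a structured language whose compilation preserves behaviour and time
(`Exec.run`), and they are verified by weakest preconditions with a clock. `wp_scan` is the
traversal of the encoded game used by both `wp_check` and `wp_build`. `wp_search` bounds the search
by a potential that pays for every vertex found, every vertex finished, every root passed and every
edge used. -/

namespace WordRAM

/-! ### A structured language on top of the machine -/

/-- The registers and the memory of a configuration. -/
structure Data : Type where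
  reg : ℕ → ℕ
  mem : ℕ → ℕ

namespace Data

/-- Write `v` to register `r`. -/
def setReg (σ : Data) (r v : ℕ) : Data := { σ with reg := Function.update σ.reg r v }

/-- Write `v` to the memory cell `a`. -/
def setMem (σ : Data) (a v : ℕ) : Data := { σ with mem := Function.update σ.mem a v }

@[simp] theorem reg_setReg (σ : Data) (r v s : ℕ) :
    (σ.setReg r v).reg s = if s = r then v else σ.reg s := by
  simp [setReg, Function.update_apply]

@[simp] theorem mem_setReg (σ : Data) (r v : ℕ) : (σ.setReg r v).mem = σ.mem := rfl

@[simp] theorem reg_setMem (σ : Data) (a v : ℕ) : (σ.setMem a v).reg = σ.reg := rfl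

@[simp] theorem mem_setMem (σ : Data) (a v : ℕ) :
    (σ.setMem a v).mem = Function.update σ.mem a v := rfl

theorem setMem_setReg (σ : Data) (r v a w : ℕ) :
    (σ.setReg r v).setMem a w = (σ.setMem a w).setReg r v := rfl

end Data

/-- Structured programs. -/
inductive Cmd : Type
  | skip
  | const (r k : ℕ)
  | add (r s t : ℕ)
  | sub (r s t : ℕ)
  | load (r s : ℕ)
  | store (r s : ℕ)
  | seq (a b : Cmd)
  /-- if the registers `s` and `t` agree then `a` else `b` -/
  | ifEq (s t : ℕ) (a b : Cmd)
  /-- while the registers `s` and `t` differ do `a` -/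
  | whileNe (s t : ℕ) (a : Cmd)

infixr:60 " ;; " => Cmd.seq

namespace Cmd

/-- The number of instructions of the machine program for a command. -/
def len : Cmd → ℕ
  | skip => 0
  | const _ _ | add _ _ _ | sub _ _ _ | load _ _ | store _ _ => 1
  | seq a b => a.len + b.len
  | ifEq _ _ a b => b.len + a.len + 2
  | whileNe _ _ a => a.len + 2

/-- The machine program for a command, to be placed at line `m`. -/
def compile : Cmd → ℕ → List Instr
  | skip, _ => []
  | const r k, _ => [.const r k]
  | add r s t, _ => [.add r s t]
  | sub r s t, _ => [.sub r s t]
  | load r s, _ => [.load r s]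
  | store r s, _ => [.store r s]
  | seq a b, m => a.compile m ++ b.compile (m + a.len)
  | ifEq s t a b, m =>
      .jumpEq s t (m + 1 + b.len + 1) :: (b.compile (m + 1) ++
        .jump (m + 1 + b.len + 1 + a.len) :: a.compile (m + 1 + b.len + 1))
  | whileNe s t a, m =>
      .jumpEq s t (m + 1 + a.len + 1) :: (a.compile (m + 1) ++ [.jump m])

@[simp] theorem length_compile (C : Cmd) (m : ℕ) : (C.compile m).length = C.len := by
  induction C generalizing m with
  | seq a b iha ihb => simp [compile, len, iha, ihb]
  | ifEq s t a b iha ihb => simp [compile, len, iha, ihb]; omega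
  | whileNe s t a ih => simp [compile, len, ih]
  | _ => rfl

end Cmd

/-- The lines of the program `P` from `m` on start with `l`. -/
def HasCode (P : List Instr) : ℕ → List Instr → Prop
  | _, [] => True
  | m, i :: l => P[m]? = some i ∧ HasCode P (m + 1) l

theorem hasCode_append {P : List Instr} {m : ℕ} {l l' : List Instr} :
    HasCode P m (l ++ l') ↔ HasCode P m l ∧ HasCode P (m + l.length) l' := by
  induction l generalizing m with
  | nil => simp [HasCode]
  | cons i l ih => simp [HasCode, ih, and_assoc, Nat.add_assoc, Nat.add_comm 1]

theorem hasCode_prefix (p l : List Instr) : HasCode (p ++ l) p.length l := by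
  induction l generalizing p with
  | nil => trivial
  | cons i l ih => exact ⟨by simp, by simpa using ih (p ++ [i])⟩

/-! ### Timed semantics and correctness of compilation -/

/-- `Exec W C σ k σ'`: the command `C` turns `σ` into `σ'` within `k` machine steps. -/
inductive Exec (W : ℕ) : Cmd → Data → ℕ → Data → Prop
  | skip {σ} : Exec W .skip σ 0 σ
  | const {σ r k} : k < W → Exec W (.const r k) σ 1 (σ.setReg r k)
  | add {σ r s t} : σ.reg s + σ.reg t < W →
      Exec W (.add r s t) σ 1 (σ.setReg r (σ.reg s + σ.reg t))
  | sub {σ r s t} : Exec W (.sub r s t) σ 1 (σ.setReg r (σ.reg s - σ.reg t))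
  | load {σ r s} : Exec W (.load r s) σ 1 (σ.setReg r (σ.mem (σ.reg s)))
  | store {σ r s} : Exec W (.store r s) σ 1 (σ.setMem (σ.reg r) (σ.reg s))
  | seq {a b σ σ' σ'' k k'} : Exec W a σ k σ' → Exec W b σ' k' σ'' →
      Exec W (.seq a b) σ (k + k') σ''
  | ifTrue {s t a b σ σ' k} : σ.reg s = σ.reg t → Exec W a σ k σ' →
      Exec W (.ifEq s t a b) σ (k + 1) σ'
  | ifFalse {s t a b σ σ' k} : σ.reg s ≠ σ.reg t → Exec W b σ k σ' →
      Exec W (.ifEq s t a b) σ (k + 2) σ'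
  | whileDone {s t a σ} : σ.reg s = σ.reg t → Exec W (.whileNe s t a) σ 1 σ
  | whileStep {s t a σ σ' σ'' k k'} : σ.reg s ≠ σ.reg t → Exec W a σ k σ' →
      Exec W (.whileNe s t a) σ' k' σ'' → Exec W (.whileNe s t a) σ (k + k' + 2) σ''

theorem Run.jump {W : ℕ} {P : List Instr} {m l j : ℕ} {reg mem : ℕ → ℕ} {b : Bool}
    (h : P[m]? = some (.jump l)) (hj : Run W P ⟨l, reg, mem⟩ j b) :
    Run W P ⟨m, reg, mem⟩ (j + 1) b :=
  .step (by simp [WordRAM.step, h]) hj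

theorem Run.jumpEq {W : ℕ} {P : List Instr} {m l j s t : ℕ} {reg mem : ℕ → ℕ} {b : Bool}
    (h : P[m]? = some (.jumpEq s t l))
    (hj : Run W P ⟨if reg s = reg t then l else m + 1, reg, mem⟩ j b) :
    Run W P ⟨m, reg, mem⟩ (j + 1) b :=
  .step (by simp [WordRAM.step, h]) hj

/-- The continuation form, extending a run backwards through a block, makes sequencing a composition
of induction hypotheses. In a loop the same code hypothesis serves the remaining iterations, because
the compiled body ends with a jump to the loop test. -/
theorem Exec.run {W : ℕ} {C : Cmd} {σ σ' : Data} {k : ℕ} (h : Exec W C σ k σ')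
    {P : List Instr} {m j : ℕ} {b : Bool} (hP : HasCode P m (C.compile m))
    (hj : Run W P ⟨m + C.len, σ'.reg, σ'.mem⟩ j b) : Run W P ⟨m, σ.reg, σ.mem⟩ (k + j) b := by
  induction h generalizing m j with
  | skip => simpa [Cmd.len] using hj
  | const hk =>
    rw [Nat.add_comm]
    exact .step (by simp [step, hP.1, hk]; rfl) hj
  | add hk =>
    rw [Nat.add_comm]
    exact .step (by simp [step, hP.1, hk]; rfl) hj
  | sub =>
    rw [Nat.add_comm]
    exact .step (by simp [step, hP.1]; rfl) hj
  | load =>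
    rw [Nat.add_comm]
    exact .step (by simp [step, hP.1]; rfl) hj
  | store =>
    rw [Nat.add_comm]
    exact .step (by simp [step, hP.1]; rfl) hj
  | seq _ _ iha ihb =>
    rw [Cmd.compile, hasCode_append, Cmd.length_compile] at hP
    rw [Nat.add_assoc]
    exact iha hP.1 (ihb hP.2 (by simpa [Cmd.len, Nat.add_assoc] using hj))
  | @ifTrue s t a b σ σ' k hst _ ih =>
    simp only [Cmd.compile, HasCode, hasCode_append, Cmd.length_compile] at hP
    rw [Nat.add_right_comm]
    refine .jumpEq hP.1 ?_
    rw [if_pos hst]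
    refine ih hP.2.2.2 ?_
    convert hj using 2
    simp only [Cmd.len]; omega
  | @ifFalse s t a b σ σ' k hst _ ih =>
    simp only [Cmd.compile, HasCode, hasCode_append, Cmd.length_compile] at hP
    rw [show k + 2 + j = k + (j + 1) + 1 by omega]
    refine .jumpEq hP.1 ?_
    rw [if_neg hst]
    refine ih hP.2.1 (.jump hP.2.2.1 ?_)
    convert hj using 2
    simp only [Cmd.len]; omega
  | @whileDone s t a σ hst =>
    simp only [Cmd.compile, HasCode, hasCode_append, Cmd.length_compile] at hP
    rw [Nat.add_comm]
    refine .jumpEq hP.1 ?_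
    rw [if_pos hst]
    convert hj using 2
    simp only [Cmd.len]; omega
  | @whileStep s t a σ σ' σ'' k k' hst _ _ iha ihb =>
    have hP' := hP
    simp only [Cmd.compile, HasCode, hasCode_append, Cmd.length_compile] at hP
    rw [show k + k' + 2 + j = k + (k' + j + 1) + 1 by omega]
    refine .jumpEq hP.1 ?_
    rw [if_neg hst]
    exact iha hP.2.1 (.jump hP.2.2.1 (ihb hP' hj))

/-! ### Weakest preconditions with a clock -/

/-- Started in `σ` at time `t`, the command `C` ends in some `σ'` at some time `t'` with
`Q σ' t'`. -/
def Wp (W : ℕ) (C : Cmd) (Q : Data → ℕ → Prop) (σ : Data) (t : ℕ) : Prop :=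
  ∃ k σ', Exec W C σ k σ' ∧ Q σ' (t + k)

section Wp

variable {W : ℕ} {Q : Data → ℕ → Prop} {σ : Data} {t : ℕ}

theorem Wp.mono {C : Cmd} {Q' : Data → ℕ → Prop} (h : Wp W C Q' σ t)
    (hQ : ∀ σ' t', Q' σ' t' → Q σ' t') : Wp W C Q σ t :=
  let ⟨k, σ', hk, hσ⟩ := h
  ⟨k, σ', hk, hQ _ _ hσ⟩

@[simp] theorem wp_skip : Wp W .skip Q σ t ↔ Q σ t :=
  ⟨fun ⟨_, _, h, hQ⟩ => by cases h; exact hQ, fun h => ⟨_, _, .skip, h⟩⟩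

@[simp] theorem wp_const {r k : ℕ} :
    Wp W (.const r k) Q σ t ↔ k < W ∧ Q (σ.setReg r k) (t + 1) :=
  ⟨fun ⟨_, _, h, hQ⟩ => by cases h with | const h => exact ⟨h, hQ⟩,
    fun h => ⟨_, _, .const h.1, h.2⟩⟩

@[simp] theorem wp_add {r s s' : ℕ} : Wp W (.add r s s') Q σ t ↔
    σ.reg s + σ.reg s' < W ∧ Q (σ.setReg r (σ.reg s + σ.reg s')) (t + 1) :=
  ⟨fun ⟨_, _, h, hQ⟩ => by cases h with | add h => exact ⟨h, hQ⟩,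
    fun h => ⟨_, _, .add h.1, h.2⟩⟩

@[simp] theorem wp_sub {r s s' : ℕ} : Wp W (.sub r s s') Q σ t ↔
    Q (σ.setReg r (σ.reg s - σ.reg s')) (t + 1) :=
  ⟨fun ⟨_, _, h, hQ⟩ => by cases h; exact hQ, fun h => ⟨_, _, .sub, h⟩⟩

@[simp] theorem wp_load {r s : ℕ} :
    Wp W (.load r s) Q σ t ↔ Q (σ.setReg r (σ.mem (σ.reg s))) (t + 1) :=
  ⟨fun ⟨_, _, h, hQ⟩ => by cases h; exact hQ, fun h => ⟨_, _, .load, h⟩⟩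

@[simp] theorem wp_store {r s : ℕ} :
    Wp W (.store r s) Q σ t ↔ Q (σ.setMem (σ.reg r) (σ.reg s)) (t + 1) :=
  ⟨fun ⟨_, _, h, hQ⟩ => by cases h; exact hQ, fun h => ⟨_, _, .store, h⟩⟩

@[simp] theorem wp_seq {a b : Cmd} : Wp W (a ;; b) Q σ t ↔ Wp W a (Wp W b Q) σ t :=
  ⟨fun ⟨_, _, h, hQ⟩ => by
    cases h with | seq h h' => exact ⟨_, _, h, _, _, h', by rwa [Nat.add_assoc]⟩,
  fun ⟨_, _, h, _, _, h', hQ⟩ => ⟨_, _, .seq h h', by rwa [← Nat.add_assoc]⟩⟩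

/-- The second branch is placed first in the code and pays one extra step for jumping over the other
one. -/
theorem wp_ifEq {s s' : ℕ} {a b : Cmd} (ha : σ.reg s = σ.reg s' → Wp W a Q σ (t + 1))
    (hb : σ.reg s ≠ σ.reg s' → Wp W b Q σ (t + 2)) : Wp W (.ifEq s s' a b) Q σ t := by
  by_cases h : σ.reg s = σ.reg s'
  · obtain ⟨k, σ', hk, hQ⟩ := ha h
    exact ⟨_, _, .ifTrue h hk, by rwa [Nat.add_right_comm, Nat.add_assoc] at hQ⟩
  · obtain ⟨k, σ', hk, hQ⟩ := hb h
    exact ⟨_, _, .ifFalse h hk, by rwa [Nat.add_right_comm, Nat.add_assoc] at hQ⟩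

/-- The rule for loops. Since every iteration takes time, an invariant that bounds the time
guarantees termination. -/
theorem wp_whileNe {s s' : ℕ} {a : Cmd} (I : Data → ℕ → Prop) (B : ℕ)
    (hB : ∀ σ t, I σ t → t ≤ B) (hI : I σ t)
    (hstep : ∀ σ t, I σ t → σ.reg s ≠ σ.reg s' → Wp W a (fun σ' t' => I σ' (t' + 1)) σ (t + 1))
    (hdone : ∀ σ t, I σ t → σ.reg s = σ.reg s' → Q σ (t + 1)) :
    Wp W (.whileNe s s' a) Q σ t := by
  induction hm : B - t using Nat.strong_induction_on generalizing σ t with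
  | _ m ih =>
    by_cases h : σ.reg s = σ.reg s'
    · exact ⟨_, _, .whileDone h, hdone σ t hI h⟩
    · obtain ⟨k, σ', hk, hI'⟩ := hstep σ t hI h
      have := hB _ _ hI'
      obtain ⟨k', σ'', hk', hQ⟩ := ih _ (by omega) hI' rfl
      exact ⟨_, _, .whileStep h hk hk', by convert hQ using 1; omega⟩

end Wp

/-- The machine program that executes `C` and then accepts iff the registers `s` and `t` agree. -/
def Cmd.program (C : Cmd) (s t : ℕ) : List Instr :=
  C.compile 0 ++ [.jumpEq s t (C.len + 2), .halt false, .halt true]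

/-- The two reserved steps are the final comparison and the halting instruction. -/
theorem answersWithin_program {C : Cmd} {s s' W T : ℕ} {x : List ℕ} {p : Prop}
    (hx : x.length < W) (hx' : ∀ a ∈ x, a < W)
    (h : Wp W C (fun σ t => t + 2 ≤ T ∧ (σ.reg s = σ.reg s' ↔ p)) ⟨(init x).reg, (init x).mem⟩ 0) :
    ∃ b : Bool, AnswersWithin (C.program s s') x W T b ∧ (b = true ↔ p) := by
  obtain ⟨k, σ, hk, ht, hp⟩ := h
  have hC : HasCode (C.program s s') 0 (C.program s s') := hasCode_prefix [] _
  generalize hP : C.program s s' = P at hC ⊢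
  rw [← hP, Cmd.program, hasCode_append, ← Cmd.program, hP] at hC
  obtain ⟨hC, hj, hf, ht', -⟩ := hC
  simp only [Cmd.length_compile] at hj hf ht'
  by_cases hs : σ.reg s = σ.reg s'
  · refine ⟨true, ⟨hx, hx', k + 2, by omega, hk.run hC (.jumpEq hj (.halt ?_))⟩,
      by simpa using hp.1 hs⟩
    simpa [hs] using ht'
  · refine ⟨false, ⟨hx, hx', k + 2, by omega, hk.run hC (.jumpEq hj (.halt ?_))⟩,
      by simpa using fun h => hs (hp.2 h)⟩
    simpa [hs] using hf

end WordRAM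

namespace WordRAM

/-! ### Reading a game from the memory -/

/-- The memory cells from `a` on contain the list. -/
def Reads (m : ℕ → ℕ) : ℕ → List ℕ → Prop
  | _, [] => True
  | a, x :: l => m a = x ∧ Reads m (a + 1) l

theorem reads_append {m : ℕ → ℕ} {a : ℕ} {l l' : List ℕ} :
    Reads m a (l ++ l') ↔ Reads m a l ∧ Reads m (a + l.length) l' := by
  induction l generalizing a with
  | nil => simp [Reads]
  | cons i l ih => simp [Reads, ih, and_assoc, Nat.add_assoc, Nat.add_comm 1]

theorem Reads.congr {m m' : ℕ → ℕ} {a : ℕ} {l : List ℕ} (h : Reads m a l)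
    (hm : ∀ b, a ≤ b → b < a + l.length → m' b = m b) : Reads m' a l := by
  induction l generalizing a with
  | nil => trivial
  | cons x l ih =>
    simp only [List.length_cons] at hm
    exact ⟨(hm a le_rfl (by omega)).trans h.1, ih h.2 fun b hb hb' => hm b (by omega) (by omega)⟩

theorem reads_getD (p l q : List ℕ) : Reads (fun a => (p ++ (l ++ q)).getD a 0) p.length l := by
  induction l generalizing p with
  | nil => trivial
  | cons x l ih => exact ⟨by simp, by simpa using ih (p ++ [x])⟩

/-- A ranked list as numbers. -/
def rankedCode (l : List (ℕ × ℕ)) : List ℕ := l.length :: l.flatMap fun p => [p.1, p.2]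

theorem length_flatMap_pair (l : List (ℕ × ℕ)) :
    (l.flatMap fun p => [p.1, p.2]).length = 2 * l.length := by
  induction l with
  | nil => rfl
  | cons x l ih => simp [ih]; omega

@[simp] theorem length_rankedCode (l : List (ℕ × ℕ)) :
    (rankedCode l).length = 2 * l.length + 1 := by
  simp only [rankedCode, List.length_cons, length_flatMap_pair]

/-- The game with the friends lists `F` and the enemies lists `E` as numbers. -/
def gameCode (n : ℕ) (F E : ℕ → List (ℕ × ℕ)) : List ℕ :=
  n :: (List.range n).flatMap fun i => rankedCode (F i) ++ rankedCode (E i)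

/-- The entries of the lists of player `i`: friendship (`true`) or enmity (`false`), `i`, and the
other player. -/
def playerEntries (F E : ℕ → List (ℕ × ℕ)) (i : ℕ) : List (Bool × ℕ × ℕ) :=
  (F i).map (fun p => (true, i, p.1)) ++ (E i).map (fun p => (false, i, p.1))

/-- The entries of all the lists of a game. -/
def entries (n : ℕ) (F E : ℕ → List (ℕ × ℕ)) : List (Bool × ℕ × ℕ) :=
  (List.range n).flatMap (playerEntries F E)

/-- Apply `body` to every entry of the ranked list at the address in register `4`, with the entry
in register `6`, and move register `4` behind the list. -/
def scanList (body : Cmd) : Cmd :=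
  .load 5 4 ;; .add 4 4 2 ;; .add 5 5 5 ;; .add 5 5 4 ;;
    .whileNe 4 5 (.load 6 4 ;; .add 4 4 2 ;; .add 4 4 2 ;; body)

/-- Apply `bF` to every friend and `bE` to every enemy of every player of the game at address `0`.
Register `1` contains the number of players, register `3` the current one, and register `2` the
number one. -/
def scan (bF bE : Cmd) : Cmd :=
  .sub 3 2 2 ;; .add 4 3 2 ;; .whileNe 3 1 (scanList bF ;; scanList bE ;; .add 3 3 2)

/-- The command `body` treats entries of kind `b` in time `c` as described by the invariant `I`,
which depends on the list of entries treated already. -/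
def Treats (W L c : ℕ) (I : List (Bool × ℕ × ℕ) → Data → Prop) (evs : List (Bool × ℕ × ℕ))
    (b : Bool) (body : Cmd) : Prop :=
  ∀ h i j rest σ t, evs = h ++ (b, i, j) :: rest → I h σ → σ.reg 2 = 1 → σ.reg 3 = i →
    σ.reg 6 = j → Wp W body (fun σ' t' => I (h ++ [(b, i, j)]) σ' ∧ t' ≤ t + c ∧
      (∀ r < 8, σ'.reg r = σ.reg r) ∧ ∀ a < L, σ'.mem a = σ.mem a) σ t

section Scan

variable {W L c : ℕ} {I : List (Bool × ℕ × ℕ) → Data → Prop} {evs : List (Bool × ℕ × ℕ)}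
  {Q : Data → ℕ → Prop}

/-- The invariant splits the list into treated entries `l₁` and pending entries `l₂`, with register
4 pointing at the latter and register 5 behind the list. Each entry costs five steps besides `body`:
three to fetch it and skip its rank, two for the loop. Set-up and the last loop test cost another
five. `hstable` makes `I` immune to this bookkeeping. -/
theorem wp_scanList {b : Bool} {body : Cmd}
    (hstable : ∀ h σ r v, 3 ≤ r → r ≤ 6 → I h σ → I h (σ.setReg r v))
    (hbody : Treats W L c I evs b body) (l : List (ℕ × ℕ)) {h rest : List (Bool × ℕ × ℕ)} {i : ℕ}
    {σ : Data} {t : ℕ} (hevs : evs = h ++ (l.map (fun p => (b, i, p.1)) ++ rest))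
    (h2 : σ.reg 2 = 1) (h3 : σ.reg 3 = i) (hl : Reads σ.mem (σ.reg 4) (rankedCode l))
    (hL : σ.reg 4 + (2 * l.length + 1) ≤ L) (hW : L < W) (hI : I h σ)
    (hQ : ∀ σ' t', I (h ++ l.map (fun p => (b, i, p.1))) σ' → t' ≤ t + 5 + (c + 5) * l.length →
      (∀ r < 4, σ'.reg r = σ.reg r) → σ'.reg 4 = σ.reg 4 + (2 * l.length + 1) →
      (∀ a < L, σ'.mem a = σ.mem a) → Q σ' t') :
    Wp W (scanList body) Q σ t := by
  obtain ⟨hlen, hl⟩ := hl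
  simp only [scanList, wp_seq, wp_load, wp_add, Data.reg_setReg, h2, hlen,
    Nat.reduceEqDiff, ↓reduceIte]
  refine ⟨by omega, by omega, by omega, ?_⟩
  refine wp_whileNe (fun σ' t' => ∃ l₁ l₂, l = l₁ ++ l₂ ∧
    I (h ++ l₁.map (fun p => (b, i, p.1))) σ' ∧ t' ≤ t + 4 + (c + 5) * l₁.length ∧
    (∀ r < 4, σ'.reg r = σ.reg r) ∧ σ'.reg 5 = σ.reg 4 + (2 * l.length + 1) ∧
    σ'.reg 4 = σ.reg 4 + (2 * l₁.length + 1) ∧ ∀ a < L, σ'.mem a = σ.mem a)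
    (t + 4 + (c + 5) * l.length) ?_ ?_ ?_ ?_
  · rintro σ' t' ⟨l₁, l₂, rfl, -, ht, -⟩
    refine ht.trans (Nat.add_le_add_left (Nat.mul_le_mul_left _ ?_) _)
    simp
  · refine ⟨[], l, rfl, ?_, by simp, ?_, by simp; omega, by simp, by simp⟩
    · simp only [List.map_nil, List.append_nil]
      repeat' first | assumption | refine hstable _ _ _ _ (by omega) (by omega) ?_
    · intro r hr
      simp only [Data.reg_setReg]
      rw [if_neg, if_neg, if_neg, if_neg] <;> omega
  · rintro σ' t' ⟨l₁, l₂, rfl, hI', ht, hr, h5, h4, hm⟩ hne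
    rcases l₂ with _ | ⟨⟨j, k⟩, l₂⟩
    · simp [h4, h5] at hne
    simp only [List.length_append, List.length_cons] at *
    have hj : σ'.mem (σ'.reg 4) = j := by
      rw [hm _ (by omega), h4]
      rw [List.flatMap_append, reads_append, length_flatMap_pair] at hl
      have := hl.2.1
      rwa [Nat.add_assoc, Nat.add_comm 1] at this
    have h2' : σ'.reg 2 = 1 := (hr 2 (by omega)).trans h2
    simp only [wp_seq, wp_load, wp_add, Data.reg_setReg, h2', hj,
      Nat.reduceEqDiff, ↓reduceIte]
    refine ⟨by omega, by omega, Wp.mono (hbody (h ++ l₁.map (fun p => (b, i, p.1))) i j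
      (l₂.map (fun p => (b, i, p.1)) ++ rest) _ _ (by simp [hevs]) ?_ ?_ ?_ ?_) ?_⟩
    · repeat' first | assumption | refine hstable _ _ _ _ (by omega) (by omega) ?_
    · simpa using h2'
    · simpa using (hr 3 (by omega)).trans h3
    · simp
    · rintro σ'' t'' ⟨hI'', ht'', hr'', hm''⟩
      refine ⟨l₁ ++ [(j, k)], l₂, by simp, by simpa using hI'', ?_, fun r hlt => ?_, ?_, ?_,
        fun a ha => ?_⟩
      · simp only [List.length_append, List.length_singleton, Nat.mul_add]
        omega
      · rw [hr'' r (by omega), ← hr r hlt]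
        simp only [Data.reg_setReg]
        rw [if_neg, if_neg, if_neg] <;> omega
      · rw [hr'' 5 (by omega)]
        simpa using h5
      · rw [hr'' 4 (by omega)]
        simp [h4]
        omega
      · rw [hm'' a ha]
        simpa using hm a ha
  · rintro σ' t' ⟨l₁, l₂, rfl, hI', ht, hr, h5, h4, hm⟩ heq
    rcases l₂ with _ | ⟨x, l₂⟩
    · rw [List.append_nil] at *
      exact hQ _ _ hI' (by omega) hr h4 hm
    · simp only [List.length_append, List.length_cons] at *
      omega

/-- The 13 steps per player are the fixed cost 5 of each of the two lists, one increment and two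
loop steps. The bodies leave all cells below `L` alone, so the unread part of the code stays
readable. -/
theorem wp_scan {bF bE : Cmd} {n : ℕ} {F E : ℕ → List (ℕ × ℕ)}
    (hstable : ∀ h σ r v, 3 ≤ r → r ≤ 6 → I h σ → I h (σ.setReg r v))
    (hF : Treats W L c I (entries n F E) true bF) (hE : Treats W L c I (entries n F E) false bE)
    {σ : Data} {t : ℕ} (hgame : Reads σ.mem 0 (gameCode n F E)) (hL : (gameCode n F E).length = L)
    (hW : L < W) (hn : n < W) (h1 : σ.reg 1 = n) (h2 : σ.reg 2 = 1) (hI : I [] σ)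
    (hQ : ∀ σ' t', I (entries n F E) σ' → t' ≤ t + 3 + 13 * n + (c + 5) * (entries n F E).length →
      (∀ a < L, σ'.mem a = σ.mem a) → Q σ' t') :
    Wp W (scan bF bE) Q σ t := by
  have hrange : ∀ i ≤ n, List.range n = List.range i ++ List.range' i (n - i) := fun i hi => by
    rw [List.range_eq_range', List.range_eq_range']
    obtain ⟨k, rfl⟩ := Nat.exists_eq_add_of_le hi
    simp [← List.range'_append_1]
  simp only [scan, wp_seq, wp_sub, wp_add, Data.reg_setReg, h2,
    Nat.reduceEqDiff, ↓reduceIte]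
  have hL' : 1 ≤ L := by rw [← hL, gameCode, List.length_cons]; omega
  refine ⟨by omega, ?_⟩
  refine wp_whileNe (fun σ' t' => ∃ i ≤ n, σ'.reg 3 = i ∧ σ'.reg 1 = n ∧ σ'.reg 2 = 1 ∧
    I ((List.range i).flatMap (playerEntries F E)) σ' ∧
    Reads σ'.mem (σ'.reg 4) ((List.range' i (n - i)).flatMap fun i =>
      rankedCode (F i) ++ rankedCode (E i)) ∧
    σ'.reg 4 + ((List.range' i (n - i)).flatMap fun i =>
      rankedCode (F i) ++ rankedCode (E i)).length = L ∧
    t' ≤ t + 2 + 13 * i + (c + 5) * ((List.range i).flatMap (playerEntries F E)).length ∧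
    ∀ a < L, σ'.mem a = σ.mem a)
    (t + 2 + 13 * n + (c + 5) * (entries n F E).length) ?_ ?_ ?_ ?_
  · rintro σ' t' ⟨i, hi, -, -, -, -, -, -, ht, -⟩
    refine ht.trans (Nat.add_le_add (by omega) (Nat.mul_le_mul_left _ ?_))
    rw [entries, hrange i hi, List.flatMap_append, List.length_append]
    omega
  · refine ⟨0, Nat.zero_le _, by simp, by simpa using h1, by simpa using h2, ?_, ?_, ?_, by simp,
      by simp⟩
    · simp only [List.range_zero, List.flatMap_nil]
      repeat' first | assumption | refine hstable _ _ _ _ (by omega) (by omega) ?_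
    · simpa [← List.range_eq_range'] using hgame.2
    · rw [← hL, gameCode]
      simp [← List.range_eq_range', Nat.add_comm]
  · rintro σ' t' ⟨i, hi, h3', h1', h2', hI', hg, hlen, ht, hm⟩ hne
    obtain ⟨k, rfl⟩ := Nat.exists_eq_add_of_lt (show i < n by omega)
    have hk : i + k + 1 - i = k + 1 := by omega
    rw [hk, List.range'_succ, List.flatMap_cons] at hg hlen
    rw [List.append_assoc, reads_append, reads_append] at hg
    simp only [List.length_append, length_rankedCode] at hg hlen
    have hr := hrange (i + 1) (by omega)
    rw [List.range_succ (n := i), show i + k + 1 - (i + 1) = k by omega] at hr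
    have hevs : entries (i + k + 1) F E = (List.range i).flatMap (playerEntries F E) ++
        ((F i).map (fun p => (true, i, p.1)) ++ ((E i).map (fun p => (false, i, p.1)) ++
          (List.range' (i + 1) k).flatMap (playerEntries F E))) := by
      rw [entries, hr]
      simp [playerEntries]
    rw [wp_seq]
    refine wp_scanList hstable hF _ hevs h2' h3' hg.1 (by omega) hW hI' ?_
    intro σ₁ t₁ hI₁ ht₁ hr₁ h4₁ hm₁
    rw [wp_seq]
    refine wp_scanList hstable hE (E i) (i := i) (by rw [hevs, List.append_assoc])
      ((hr₁ 2 (by omega)).trans h2') ((hr₁ 3 (by omega)).trans h3') ?_ (by omega) hW hI₁ ?_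
    · rw [h4₁]
      refine hg.2.1.congr fun a ha ha' => ?_
      rw [length_rankedCode] at ha'
      exact hm₁ a (by omega)
    intro σ₂ t₂ hI₂ ht₂ hr₂ h4₂ hm₂
    have e2 : σ₂.reg 2 = 1 := (hr₂ 2 (by omega)).trans ((hr₁ 2 (by omega)).trans h2')
    have e3 : σ₂.reg 3 = i := (hr₂ 3 (by omega)).trans ((hr₁ 3 (by omega)).trans h3')
    have e1 : σ₂.reg 1 = i + k + 1 := (hr₂ 1 (by omega)).trans ((hr₁ 1 (by omega)).trans h1')
    simp only [wp_add, e2, e3]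
    refine ⟨by omega, i + 1, by omega, by simp, by simpa using e1, by simpa using e2, ?_, ?_, ?_,
      ?_, ?_⟩
    · refine hstable _ _ _ _ (by omega) (by omega) ?_
      simpa [List.range_succ, playerEntries] using hI₂
    · rw [show i + k + 1 - (i + 1) = k by omega]
      simp only [Data.mem_setReg, Data.reg_setReg, Nat.reduceEqDiff,
        ↓reduceIte]
      rw [h4₂, h4₁]
      refine hg.2.2.congr fun a ha ha' => ?_
      rw [hm₂ a (by omega), hm₁ a (by omega)]
    · rw [show i + k + 1 - (i + 1) = k by omega]
      simp only [Data.reg_setReg, Nat.reduceEqDiff,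
        ↓reduceIte]
      omega
    · simp only [List.range_succ, List.flatMap_append, List.length_append, List.flatMap_cons,
        List.flatMap_nil, List.append_nil, playerEntries, List.length_map, Nat.mul_add] at ht ⊢
      omega
    · intro a ha
      rw [Data.mem_setReg, hm₂ a ha, hm₁ a ha, hm a ha]
  · rintro σ' t' ⟨i, hi, h3', h1', h2', hI', hg, hlen, ht, hm⟩ heq
    obtain rfl : i = n := by omega
    exact hQ _ _ hI' (by rw [entries]; omega) hm

end Scan

/-! ### Checking the names of the coalitions -/

/-- Load the names of the coalitions of the players in the registers `3` and `6`, where the names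
are listed from the address in register `7` on. -/
def loadNames : Cmd := .add 9 7 3 ;; .load 9 9 ;; .add 10 7 6 ;; .load 10 10

/-- Set register `8` to a nonzero value unless all friends have equal names and all enemies have
different names. -/
def check : Cmd :=
  .sub 8 2 2 ;; scan (loadNames ;; .ifEq 9 10 .skip (.add 8 2 11))
    (loadNames ;; .ifEq 9 10 (.add 8 2 11) .skip)

/-- The names `g` are as wanted in a perfect coalition structure. -/
def Fits (g : ℕ → ℕ) (e : Bool × ℕ × ℕ) : Prop := e.1 = true ↔ g e.2.1 = g e.2.2

/-- Register 8 starts at zero and is only ever set to one, the sum of registers 2 and 11, so it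
stays zero exactly if no entry is violated. The cost 7 per entry consists of four steps for the
names and at most three for the conditional. -/
theorem wp_check {W L A n : ℕ} {F E : ℕ → List (ℕ × ℕ)} {g : ℕ → ℕ} {Q : Data → ℕ → Prop}
    (hlt : ∀ e ∈ entries n F E, e.2.1 < n ∧ e.2.2 < n)
    {σ : Data} {t : ℕ} (hgame : Reads σ.mem 0 (gameCode n F E)) (hL : (gameCode n F E).length = L)
    (hLA : L ≤ A) (hW : A + n < W) (h1 : σ.reg 1 = n) (h2 : σ.reg 2 = 1) (h7 : σ.reg 7 = A)
    (h11 : σ.reg 11 = 0) (hg : ∀ i < n, σ.mem (A + i) = g i)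
    (hQ : ∀ σ' t', σ'.reg 11 = 0 → (σ'.reg 8 = 0 ↔ ∀ e ∈ entries n F E, Fits g e) →
      t' ≤ t + 4 + 13 * n + 12 * (entries n F E).length → Q σ' t') :
    Wp W check Q σ t := by
  have hL' : 1 ≤ L := by rw [← hL, gameCode, List.length_cons]; omega
  rw [check, wp_seq, wp_sub, h2]
  let I : List (Bool × ℕ × ℕ) → Data → Prop := fun h σ => σ.reg 7 = A ∧ σ.reg 11 = 0 ∧
    (σ.reg 8 = 0 ↔ ∀ e ∈ h, Fits g e) ∧ ∀ i < n, σ.mem (A + i) = g i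
  have hbody : ∀ b (C : Cmd), C = (if b then .ifEq 9 10 .skip (.add 8 2 11) else
      .ifEq 9 10 (.add 8 2 11) .skip) →
      Treats W L 7 I (entries n F E) b (loadNames ;; C) := by
    rintro b C hC h i j rest σ t hevs ⟨h7, h11, h8, hg⟩ h2 h3 h6
    obtain ⟨hi, hj⟩ : i < n ∧ j < n := hlt (b, i, j) (by simp [hevs])
    simp only [loadNames, wp_seq, wp_add, wp_load, Data.reg_setReg, Data.mem_setReg, h7, h3, h6,
      Nat.reduceEqDiff, ↓reduceIte, hg i hi, hg j hj]
    refine ⟨by omega, by omega, ?_⟩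
    cases b <;> subst hC <;> simp only [if_true, Bool.false_eq_true, if_false] <;>
    refine wp_ifEq (fun heq => ?_) fun heq => ?_ <;>
    simp only [Data.reg_setReg, wp_skip, wp_add, Nat.reduceEqDiff, ↓reduceIte] at heq ⊢ <;>
    (try refine ⟨by omega, ?_⟩) <;>
    refine ⟨⟨?_, ?_, ?_, ?_⟩, by omega, ?_, fun _ _ => rfl⟩ <;>
    (try simp only [Data.reg_setReg, Nat.reduceEqDiff, ↓reduceIte]) <;>
    first
    | exact h7
    | exact h11
    | exact hg
    | (intro r hr; split_ifs <;> omega)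
    | simp_all [Fits, or_imp, forall_and]
  refine wp_scan (c := 7) (I := I) ?_ (hbody true _ rfl) (hbody false _ rfl) hgame hL (by omega)
    (by omega) (by simpa using h1) (by simpa using h2) ?_ ?_
  · rintro h σ r v hr hr' ⟨h7, h11, h8, hg⟩
    refine ⟨?_, ?_, ?_, hg⟩ <;> rw [Data.reg_setReg, if_neg (by omega)] <;> assumption
  · exact ⟨by simpa using h7, by simpa using h11, by simp, hg⟩
  · rintro σ' t' ⟨-, h11, h8, -⟩ ht -
    exact hQ σ' t' h11 h8 (by omega)

end WordRAM

namespace WordRAM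

/-! ### Adjacency lists -/

/-- A linked list that starts at the address `a` and has its nodes between `lo` and `hi`. -/
def Chain (m : ℕ → ℕ) (lo hi : ℕ) : ℕ → List ℕ → Prop
  | a, [] => a = 0
  | a, y :: l => lo ≤ a ∧ a + 1 < hi ∧ m a = y ∧ Chain m lo hi (m (a + 1)) l

theorem Chain.congr {m m' : ℕ → ℕ} {lo hi hi' a : ℕ} {l : List ℕ} (h : Chain m lo hi a l)
    (hm : ∀ b, lo ≤ b → b < hi → m' b = m b) (hhi : hi ≤ hi') : Chain m' lo hi' a l := by
  induction l generalizing a with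
  | nil => exact h
  | cons x l ih =>
    obtain ⟨h₁, h₂, h₃, h₄⟩ := h
    refine ⟨h₁, by omega, by rw [hm a h₁ (by omega), h₃], ?_⟩
    rw [hm (a + 1) (by omega) h₂]
    exact ih h₄

/-- The subtraction-free form counts edges both when one is inserted and when the search uses one
up. -/
theorem sum_length_update {n x : ℕ} (hx : x < n) (adj : ℕ → List ℕ) (l : List ℕ) :
    ∑ z ∈ Finset.range n, (Function.update adj x l z).length + (adj x).length =
      ∑ z ∈ Finset.range n, (adj z).length + l.length := by
  have hx' := Finset.mem_range.2 hx
  rw [← Finset.add_sum_erase _ _ hx', ← Finset.add_sum_erase _ (fun z => (adj z).length) hx',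
    Function.update_self, Finset.sum_congr rfl fun z hz => by
      rw [Function.update_of_ne (Finset.ne_of_mem_erase hz)]]
  omega

/-- The adjacency lists of the edges `es` on the vertices below `n` are in the memory: the cell
`L + x` has the address of the list of `x`, the cells between `L + n` and `lo` are empty, and the
lists are between `lo` and the address in register `9`. -/
structure Linked (L n lo : ℕ) (es : List (ℕ × ℕ)) (σ : Data) : Prop where
  reg0 : σ.reg 0 = L
  reg1 : σ.reg 1 = n
  reg2 : σ.reg 2 = 1
  reg7 : σ.reg 7 = L + n
  reg9 : σ.reg 9 = lo + 2 * es.length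
  reg11 : σ.reg 11 = 0
  empty : ∀ a, L + n ≤ a → a < lo → σ.mem a = 0
  lists : ∃ adj : ℕ → List ℕ, (∀ x < n, Chain σ.mem lo (σ.reg 9) (σ.mem (L + x)) (adj x)) ∧
    (∀ x y, y ∈ adj x ↔ (x, y) ∈ es) ∧ ∑ x ∈ Finset.range n, (adj x).length = es.length

/-- Insert the vertex in register `b` into the list of the vertex in register `a`. -/
def link (a b : ℕ) : Cmd :=
  .add 10 0 a ;; .load 12 10 ;; .store 9 b ;; .store 10 9 ;; .add 9 9 2 ;; .store 9 12 ;; .add 9 9 2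

/-- The new node becomes the head of the list. Only the head cell of `i`, below `lo`, and two fresh
cells from register 9 on are written, so all old nodes survive. -/
theorem wp_link {W L n lo a b i j : ℕ} {es : List (ℕ × ℕ)} {σ : Data} {t : ℕ}
    {Q : Data → ℕ → Prop} (hσ : Linked L n lo es σ) (hlo : L + n ≤ lo)
    (hW : lo + 2 * es.length + 2 < W) (hb : b < 8) (hi : σ.reg a = i)
    (hj : σ.reg b = j) (hin : i < n)
    (hQ : ∀ σ', Linked L n lo (es ++ [(i, j)]) σ' → (∀ r < 8, σ'.reg r = σ.reg r) →
      (∀ a < L, σ'.mem a = σ.mem a) → Q σ' (t + 7)) : Wp W (link a b) Q σ t := by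
  obtain ⟨h0, h1, h2, h7, h9, h11, he, adj, hadj, hes, hlen⟩ := hσ
  have hb' : b ≠ 9 ∧ b ≠ 10 ∧ b ≠ 12 := by omega
  simp only [link, wp_seq, wp_add, wp_load, wp_store, Data.reg_setReg, Data.mem_setReg,
    Data.reg_setMem, Nat.reduceEqDiff, ↓reduceIte, hb', h0, h2, h9, hi, hj]
  refine ⟨by omega, by omega, by omega, hQ _ ?_ (fun r hr => ?_) fun c hc => ?_⟩
  · rw [h9] at hadj
    constructor <;>
      simp only [Data.reg_setReg, Data.mem_setReg, Data.reg_setMem, Data.mem_setMem,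
        Nat.reduceEqDiff, OfNat.zero_ne_ofNat, OfNat.one_ne_ofNat, ↓reduceIte,
        List.length_append, List.length_singleton]
    · exact h0
    · exact h1
    · exact h2
    · exact h7
    · omega
    · exact h11
    · intro c hc hc'
      rw [Function.update_of_ne (by omega), Function.update_of_ne (by omega),
        Function.update_of_ne (by omega), he c hc hc']
    · refine ⟨Function.update adj i (j :: adj i), fun x hx => ?_, fun x y => ?_, ?_⟩
      · have hm : ∀ c, lo ≤ c → c < lo + 2 * es.length →
            Function.update (Function.update (Function.update σ.mem (lo + 2 * es.length) j) (L + i)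
              (lo + 2 * es.length)) (lo + 2 * es.length + 1) (σ.mem (L + i)) c = σ.mem c := by
          intro c hc hc'
          rw [Function.update_of_ne (by omega), Function.update_of_ne (by omega),
            Function.update_of_ne (by omega)]
        by_cases hxi : x = i
        · subst hxi
          rw [Function.update_self, Function.update_of_ne (by omega), Function.update_self]
          refine ⟨by omega, by omega, ?_, ?_⟩
          · rw [Function.update_of_ne (by omega), Function.update_of_ne (by omega),
              Function.update_self]
          · rw [Function.update_self]
            exact (hadj x hx).congr hm (by omega)
        · rw [Function.update_of_ne (by omega), Function.update_of_ne (by omega),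
            Function.update_of_ne (by omega), Function.update_of_ne hxi]
          exact (hadj x hx).congr hm (by omega)
      · by_cases hxi : x = i
        · subst hxi
          simp [hes, or_comm]
        · simp [hes, hxi]
      · have := sum_length_update hin adj (j :: adj i)
        rw [List.length_cons] at this
        omega
  · simp only [Data.reg_setReg, Data.reg_setMem]
    rw [if_neg, if_neg, if_neg, if_neg] <;> omega
  · simp only [Data.mem_setReg, Data.mem_setMem]
    rw [Function.update_of_ne (by omega), Function.update_of_ne (by omega),
      Function.update_of_ne (by omega)]

/-! ### The friendship graph -/

/-- The edges, in both directions, that are given by the friendships among the entries. -/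
def edges (h : List (Bool × ℕ × ℕ)) : List (ℕ × ℕ) :=
  h.flatMap fun e => if e.1 then [e.2, e.2.swap] else []

theorem length_edges_le (h : List (Bool × ℕ × ℕ)) : (edges h).length ≤ 2 * h.length := by
  induction h with
  | nil => rfl
  | cons e h ih =>
    have : (edges (e :: h)).length = (if e.1 then 2 else 0) + (edges h).length := by
      cases he : e.1 <;> simp [edges, he]
      omega
    rw [this, List.length_cons]
    split_ifs <;> omega

theorem mem_edges {h : List (Bool × ℕ × ℕ)} {x y : ℕ} :
    (x, y) ∈ edges h ↔ (true, x, y) ∈ h ∨ (true, y, x) ∈ h := by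
  simp only [edges, List.mem_flatMap]
  constructor
  · rintro ⟨⟨b, i, j⟩, he, hxy⟩
    cases b
    · simp at hxy
    · simp only [↓reduceIte, Prod.swap_prod_mk, List.mem_cons, Prod.mk.injEq, List.not_mem_nil,
        or_false] at hxy
      rcases hxy with ⟨rfl, rfl⟩ | ⟨rfl, rfl⟩
      · exact .inl he
      · exact .inr he
  · rintro (h | h)
    · exact ⟨_, h, by simp⟩
    · exact ⟨_, h, by simp⟩

/-- Build the adjacency lists of the friendships. -/
def build : Cmd := scan (link 3 6 ;; link 6 3) .skip

theorem wp_build {W L lo n : ℕ} {F E : ℕ → List (ℕ × ℕ)} {Q : Data → ℕ → Prop}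
    (hlt : ∀ e ∈ entries n F E, e.2.1 < n ∧ e.2.2 < n)
    {σ : Data} {t : ℕ} (hgame : Reads σ.mem 0 (gameCode n F E)) (hL : (gameCode n F E).length = L)
    (hlo : L + n ≤ lo) (hW : lo + 4 * (entries n F E).length + 2 < W) (hI : Linked L n lo [] σ)
    (hQ : ∀ σ' t', Linked L n lo (edges (entries n F E)) σ' →
      t' ≤ t + 3 + 13 * n + 19 * (entries n F E).length →
      (∀ a < L, σ'.mem a = σ.mem a) → Q σ' t') : Wp W build Q σ t := by
  refine wp_scan (c := 14) (I := fun h => Linked L n lo (edges h)) ?_ ?_ ?_ hgame hL (by omega)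
    (by omega) hI.reg1 hI.reg2 hI hQ
  · rintro h σ r v hr hr' ⟨h0, h1, h2, h7, h9, h11, he, hl⟩
    constructor <;> simp only [Data.mem_setReg, Data.reg_setReg] <;> (try rw [if_neg (by omega)]) <;>
      assumption
  · intro h i j rest σ t hevs hI h2 h3 h6
    obtain ⟨hi, hj⟩ : i < n ∧ j < n := hlt (true, i, j) (by simp [hevs])
    have hlen := length_edges_le h
    have hlen' := congrArg List.length hevs
    rw [List.length_append, List.length_cons] at hlen'
    have he : edges (h ++ [(true, i, j)]) = edges h ++ [(i, j)] ++ [(j, i)] := by simp [edges]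
    rw [wp_seq]
    refine wp_link hI hlo (by omega) (by omega) h3 h6 hi fun σ₁ hI₁ hr₁ hm₁ => ?_
    refine wp_link hI₁ hlo ?_ (by omega) ((hr₁ 6 (by omega)).trans h6)
      ((hr₁ 3 (by omega)).trans h3) hj fun σ₂ hI₂ hr₂ hm₂ => ?_
    · rw [List.length_append, List.length_singleton]
      omega
    · exact ⟨by simpa only [he] using hI₂, by omega, fun r hr => (hr₂ r hr).trans (hr₁ r hr),
        fun a ha => (hm₂ a ha).trans (hm₁ a ha)⟩
  · intro h i j rest σ t hevs hI h2 h3 h6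
    rw [wp_skip]
    exact ⟨by simpa [edges] using hI, by omega, fun _ _ => rfl, fun _ _ => rfl⟩

/-! ### Connected components -/

/-- The state of a graph search: the names `col` of the components of the vertices (`0` for the
vertices that were not found yet), the edges `adj` that were not used yet, the vertices `fin` that
are finished, the vertices `pend` that were found but are not finished, and the current root. -/
structure Searching (n : ℕ) (es : List (ℕ × ℕ)) (col : ℕ → ℕ) (adj : ℕ → List ℕ)
    (fin pend : List ℕ) (r : ℕ) : Prop where
  le : r ≤ n
  last : r < n ∨ pend = []
  nodup : (fin ++ pend).Nodup
  lt : ∀ x ∈ fin ++ pend, x < n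
  found : ∀ x < n, col x ≠ 0 ↔ x ∈ fin ++ pend
  finished : ∀ x ∈ fin, adj x = []
  current : ∀ x ∈ pend, col x = r + 1
  edge : ∀ x y, (x, y) ∈ es → y ∈ adj x ∨ (col x ≠ 0 ∧ col x = col y)
  unused : ∀ x y, y ∈ adj x → (x, y) ∈ es
  roots : ∀ x < r, col x ≠ 0
  reach : ∀ x < n, col x ≠ 0 → Relation.EqvGen (fun x y => (x, y) ∈ es) (col x - 1) x

namespace Searching

variable {n : ℕ} {es : List (ℕ × ℕ)} {col : ℕ → ℕ} {adj : ℕ → List ℕ} {fin pend l : List ℕ}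
  {r x y : ℕ}

/-- These are distinct vertices. The bound keeps the queue inside its `n` cells and limits the
potential in the time analysis. -/
theorem length_le (h : Searching n es col adj fin pend r) : fin.length + pend.length ≤ n := by
  have := (List.Nodup.subperm h.nodup (l₂ := List.range n)
    fun x hx => List.mem_range.2 (h.lt x hx)).length_le
  simpa using this

theorem start (h : Searching n es col adj fin [] r) (hr : r < n) (h0 : col r = 0) :
    Searching n es (Function.update col r (r + 1)) adj fin [r] r := by
  obtain ⟨h₁, h₂, h₃, h₄, h₅, h₆, h₇, h₈, h₉, h₁₀, h₁₁⟩ := h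
  rw [List.append_nil] at *
  have hfin : r ∉ fin := fun hf => (h₅ r hr).2 hf h0
  refine ⟨h₁, .inl hr, ?_, ?_, fun x hx => ?_, h₆, ?_, fun x y hxy => ?_, h₉, fun x hx => ?_,
    fun x hx hcol => ?_⟩
  · rw [List.nodup_append]
    exact ⟨h₃, by simp, fun a ha b hb hab => hfin (by simp_all)⟩
  · simp only [List.mem_append, List.mem_singleton]
    rintro x (hx | rfl)
    · exact h₄ x hx
    · exact hr
  · by_cases hxr : x = r
    · simp [hxr]
    · simpa [hxr] using h₅ x hx
  · simp
  · refine (h₈ x y hxy).imp_right fun ⟨hx, hxy⟩ => ?_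
    rw [Function.update_of_ne, Function.update_of_ne]
    · exact ⟨hx, hxy⟩
    · rintro rfl; exact hx (hxy.trans h0)
    · rintro rfl; exact hx h0
  · rw [Function.update_of_ne hx.ne]
    exact h₁₀ x hx
  · by_cases hxr : x = r
    · subst hxr; simpa using Relation.EqvGen.refl _
    · rw [Function.update_of_ne hxr] at hcol ⊢
      exact h₁₁ x hx hcol

theorem next (h : Searching n es col adj fin [] r) (hr : r < n) (h0 : col r ≠ 0) :
    Searching n es col adj fin [] (r + 1) := by
  obtain ⟨h₁, h₂, h₃, h₄, h₅, h₆, h₇, h₈, h₉, h₁₀, h₁₁⟩ := h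
  refine ⟨hr, .inr rfl, h₃, h₄, h₅, h₆, by simp, h₈, h₉, fun x hx => ?_, h₁₁⟩
  rcases Nat.lt_succ_iff_lt_or_eq.1 hx with hx | rfl
  · exact h₁₀ x hx
  · exact h0

theorem pop (h : Searching n es col adj fin (x :: pend) r) (hx : adj x = []) :
    Searching n es col adj (fin ++ [x]) pend r := by
  obtain ⟨h₁, h₂, h₃, h₄, h₅, h₆, h₇, h₈, h₉, h₁₀, h₁₁⟩ := h
  refine ⟨h₁, .inl (by simpa using h₂), by simpa using h₃, by simpa using h₄, by simpa using h₅,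
    ?_, fun y hy => h₇ y (by simp [hy]), h₈, h₉, h₁₀, h₁₁⟩
  simp only [List.mem_append, List.mem_singleton]
  rintro y (hy | rfl)
  · exact h₆ y hy
  · exact hx

/-- The used edge must join equal names. A pending `y` carries the current name. A finished `y` has
no unused edge left, so its reverse edge to `x` was settled already; this is where symmetry is
needed. -/
theorem visit_found (hlt : ∀ x y, (x, y) ∈ es → y < n) (hsymm : ∀ x y, (x, y) ∈ es → (y, x) ∈ es)
    (h : Searching n es col adj fin (x :: pend) r) (hx : adj x = y :: l) (hy : col y ≠ 0) :
    Searching n es col (Function.update adj x l) fin (x :: pend) r := by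
  obtain ⟨h₁, h₂, h₃, h₄, h₅, h₆, h₇, h₈, h₉, h₁₀, h₁₁⟩ := h
  have hxy : (x, y) ∈ es := h₉ x y (by simp [hx])
  have hcol : col x = r + 1 := h₇ x (by simp)
  have hfin : x ∉ fin := fun hf => (List.nodup_append.1 h₃).2.2 x hf x (by simp) rfl
  have heq : col x = col y := by
    rcases List.mem_append.1 ((h₅ y (hlt x y hxy)).1 hy) with hf | hp
    · rcases h₈ y x (hsymm x y hxy) with h | h
      · simp [h₆ y hf] at h
      · exact h.2.symm
    · rw [hcol, h₇ y hp]
  refine ⟨h₁, h₂, h₃, h₄, h₅, fun z hz => ?_, h₇, fun u v huv => ?_, fun u v huv => ?_, h₁₀, h₁₁⟩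
  · rw [Function.update_of_ne (by rintro rfl; exact hfin hz), h₆ z hz]
  · by_cases hu : u = x
    · subst hu
      rcases h₈ u v huv with hv | hv
      · rw [hx, List.mem_cons] at hv
        rcases hv with rfl | hv
        · exact .inr ⟨by omega, heq⟩
        · exact .inl (by simpa using hv)
      · exact .inr hv
    · simpa [hu] using h₈ u v huv
  · by_cases hu : u = x
    · subst hu
      exact h₉ u v (by simp_all)
    · exact h₉ u v (by simpa [hu] using huv)

/-- Naming `y` breaks no settled edge, since both ends of a settled edge have nonzero names. The
edge from `x` prolongs the connection between the root and `x`. -/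
theorem visit_new (hlt : ∀ x y, (x, y) ∈ es → y < n)
    (h : Searching n es col adj fin (x :: pend) r) (hx : adj x = y :: l) (hy : col y = 0) :
    Searching n es (Function.update col y (r + 1)) (Function.update adj x l) fin
      (x :: pend ++ [y]) r := by
  obtain ⟨h₁, h₂, h₃, h₄, h₅, h₆, h₇, h₈, h₉, h₁₀, h₁₁⟩ := h
  have hxy : (x, y) ∈ es := h₉ x y (by simp [hx])
  have hyn := hlt x y hxy
  have hcol : col x = r + 1 := h₇ x (by simp)
  have hne : x ≠ y := by rintro rfl; omega
  have hfin : x ∉ fin := fun hf => (List.nodup_append.1 h₃).2.2 x hf x (by simp) rfl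
  have hnew : y ∉ fin ++ x :: pend := fun hf => (h₅ y hyn).2 hf hy
  refine ⟨h₁, .inl (by simpa using h₂), ?_, ?_, fun z hz => ?_, fun z hz => ?_, fun z hz => ?_,
    fun u v huv => ?_, fun u v huv => ?_, fun z hz => ?_, fun z hz hc => ?_⟩
  · rw [← List.append_assoc, List.nodup_append]
    exact ⟨h₃, by simp, fun a ha b hb hab => hnew (by simp_all)⟩
  · rw [← List.append_assoc]
    intro z hz
    rcases List.mem_append.1 hz with hz | hz
    · exact h₄ z hz
    · rwa [List.mem_singleton.1 hz]
  · rw [← List.append_assoc]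
    by_cases hzy : z = y
    · simp [hzy]
    · rw [Function.update_of_ne hzy, h₅ z hz]
      simp [hzy]
  · rw [Function.update_of_ne (by rintro rfl; exact hfin hz), h₆ z hz]
  · by_cases hzy : z = y
    · simp [hzy]
    · rw [Function.update_of_ne hzy]
      exact h₇ z (by simpa [hzy] using hz)
  · have hold : ∀ u v, col u ≠ 0 ∧ col u = col v → Function.update col y (r + 1) u ≠ 0 ∧
        Function.update col y (r + 1) u = Function.update col y (r + 1) v := by
      rintro u v ⟨hu, huv⟩
      rw [Function.update_of_ne, Function.update_of_ne]
      · exact ⟨hu, huv⟩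
      · rintro rfl; exact hu (huv.trans hy)
      · rintro rfl; exact hu hy
    by_cases hu : u = x
    · subst hu
      rcases h₈ u v huv with hv | hv
      · rw [hx, List.mem_cons] at hv
        rcases hv with rfl | hv
        · right
          rw [Function.update_self, Function.update_of_ne hne]
          omega
        · exact .inl (by simpa using hv)
      · exact .inr (hold u v hv)
    · rw [Function.update_of_ne hu]
      exact (h₈ u v huv).imp_right (hold u v)
  · by_cases hu : u = x
    · subst hu
      exact h₉ u v (by simp_all)
    · exact h₉ u v (by simpa [hu] using huv)
  · by_cases hzy : z = y
    · simp [hzy]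
    · rw [Function.update_of_ne hzy]
      exact h₁₀ z hz
  · by_cases hzy : z = y
    · subst hzy
      rw [Function.update_self]
      refine .trans _ _ _ ?_ (.rel _ _ hxy)
      simpa [hcol] using h₁₁ x (h₄ x (by simp)) (by omega)
    · rw [Function.update_of_ne hzy] at hc ⊢
      exact h₁₁ z hz hc

/-- When the roots are exhausted the queue is empty and every vertex is found, hence finished. No
edge is left unused, so each one is settled. -/
theorem eq_of_mem (hlt : ∀ x y, (x, y) ∈ es → x < n)
    (h : Searching n es col adj fin pend n) (hxy : (x, y) ∈ es) : col x = col y := by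
  obtain ⟨h₁, h₂, h₃, h₄, h₅, h₆, h₇, h₈, h₉, h₁₀, h₁₁⟩ := h
  obtain rfl : pend = [] := h₂.resolve_left (lt_irrefl _)
  rcases h₈ x y hxy with h | h
  · have hf := (h₅ x (hlt x y hxy)).1 (h₁₀ x (hlt x y hxy))
    rw [List.append_nil] at hf
    simp [h₆ x hf] at h
  · exact h.2

/-- Vertices with equal names are connected to the same root, the name minus one. -/
theorem eqvGen_of_eq (h : Searching n es col adj fin pend n) (hx : x < n) (hy : y < n)
    (hxy : col x = col y) : Relation.EqvGen (fun x y => (x, y) ∈ es) x y := by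
  have h₁ := h.reach x hx (h.roots x hx)
  have h₂ := h.reach y hy (h.roots y hy)
  rw [hxy] at h₁
  exact .trans _ _ _ (.symm _ _ h₁) h₂

end Searching

/-! ### The search on the machine -/

/-- The graph search finds the vertex in register `s`, whose name is in the cell with the address in
register `10`. -/
def visit (s : ℕ) : Cmd := .add 12 3 2 ;; .store 10 12 ;; .store 5 s ;; .add 5 5 2

/-- One step of the graph search. -/
def searchStep : Cmd :=
  .ifEq 4 5
    (.add 10 7 3 ;; .load 12 10 ;; .ifEq 12 11 (visit 3) (.add 3 3 2))
    (.load 10 4 ;; .add 10 0 10 ;; .load 12 10 ;; .ifEq 12 11 (.add 4 4 2)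
      (.load 13 12 ;; .add 12 12 2 ;; .load 12 12 ;; .store 10 12 ;; .add 10 7 13 ;; .load 12 10 ;;
        .ifEq 12 11 (visit 13) .skip))

/-- Write to the cells from the address in register `7` on a name for the connected component of
every vertex. The vertices that were found are listed behind the names, the ones that are not
finished between the addresses in the registers `4` and `5`; register `3` contains the root. -/
def search : Cmd := .sub 3 2 2 ;; .add 4 7 1 ;; .add 5 7 1 ;; .whileNe 3 1 searchStep

/-- The state of the machine in a graph search. -/
structure SearchState (L n hi : ℕ) (m₀ : ℕ → ℕ) (col : ℕ → ℕ) (adj : ℕ → List ℕ)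
    (fin pend : List ℕ) (r : ℕ) (σ : Data) : Prop where
  reg0 : σ.reg 0 = L
  reg1 : σ.reg 1 = n
  reg2 : σ.reg 2 = 1
  reg3 : σ.reg 3 = r
  reg4 : σ.reg 4 = L + n + n + fin.length
  reg5 : σ.reg 5 = L + n + n + fin.length + pend.length
  reg7 : σ.reg 7 = L + n
  reg11 : σ.reg 11 = 0
  input : ∀ a < L, σ.mem a = m₀ a
  names : ∀ x < n, σ.mem (L + n + x) = col x
  pending : Reads σ.mem (L + n + n + fin.length) pend
  lists : ∀ x < n, Chain σ.mem (L + n + n + n) hi (σ.mem (L + x)) (adj x)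

namespace SearchState

variable {W L n hi : ℕ} {m₀ col : ℕ → ℕ} {adj : ℕ → List ℕ} {fin pend : List ℕ} {r : ℕ} {σ : Data}

theorem setReg (h : SearchState L n hi m₀ col adj fin pend r σ) {s v : ℕ}
    (hs : s = 10 ∨ s = 12 ∨ s = 13) :
    SearchState L n hi m₀ col adj fin pend r (σ.setReg s v) := by
  obtain ⟨h0, h1, h2, h3, h4, h5, h7, h11, hin, hn, hp, hl⟩ := h
  constructor <;> simp only [Data.reg_setReg, Data.mem_setReg] <;> (try rw [if_neg (by omega)]) <;>
    assumption

/-- Two cells change, the name of `y` and the first free queue cell. By `hlen` the latter still lies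
below the nodes of the adjacency lists. -/
theorem visit (h : SearchState L n hi m₀ col adj fin pend r σ) {Q : Data → ℕ → Prop} {s t y : ℕ}
    (hs : s ≠ 12) (hsy : σ.reg s = y) (hy : y < n) (h10 : σ.reg 10 = L + n + y)
    (hlen : fin.length + pend.length < n) (hr : r < n) (hW : L + n + n + n < W)
    (hQ : ∀ σ', SearchState L n hi m₀ (Function.update col y (r + 1)) adj fin (pend ++ [y]) r σ' →
      Q σ' (t + 4)) : Wp W (visit s) Q σ t := by
  obtain ⟨h0, h1, h2, h3, h4, h5, h7, h11, hin, hn, hp, hl⟩ := h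
  simp only [WordRAM.visit, wp_seq, wp_add, wp_store, Data.reg_setReg,
    Data.reg_setMem, Nat.reduceEqDiff, ↓reduceIte, hs, h2, h3, h5, h10, hsy]
  refine ⟨by omega, by omega, hQ _ ?_⟩
  have hm : ∀ c, c ≠ L + n + y → c ≠ L + n + n + fin.length + pend.length →
      Function.update (Function.update σ.mem (L + n + y) (r + 1))
        (L + n + n + fin.length + pend.length) y c = σ.mem c := fun c hc hc' => by
    rw [Function.update_of_ne hc', Function.update_of_ne hc]
  constructor <;>
    simp only [Data.reg_setReg, Data.mem_setReg, Data.reg_setMem, Data.mem_setMem,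
      Nat.reduceEqDiff, OfNat.zero_ne_ofNat, OfNat.one_ne_ofNat, ↓reduceIte, List.length_append,
      List.length_singleton, ← Nat.add_assoc]
  any_goals assumption
  · intro a ha
    rw [hm a (by omega) (by omega), hin a ha]
  · intro x hx
    by_cases hxy : x = y
    · subst hxy
      rw [Function.update_of_ne (by omega), Function.update_self, Function.update_self]
    · rw [hm _ (by omega) (by omega), Function.update_of_ne hxy, hn x hx]
  · rw [reads_append]
    exact ⟨hp.congr fun b hb hb' => hm b (by omega) (by omega), Function.update_self .., trivial⟩
  · intro x hx
    rw [hm _ (by omega) (by omega)]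
    exact (hl x hx).congr (fun b hb hb' => hm b (by omega) (by omega)) le_rfl

end SearchState

/-- Every step increases `r + 2 * fin.length + pend.length` minus the number of unused edges: a new
root or a found vertex enters the queue, the root advances, a vertex moves from `pend` to `fin`
(hence the weight two), or an edge is used. Each unit pays 20 machine steps, including the two steps
of the surrounding loop. -/
theorem wp_searchStep {W L n hi : ℕ} {m₀ col : ℕ → ℕ} {adj : ℕ → List ℕ} {fin pend : List ℕ}
    {r : ℕ} {σ : Data} {t : ℕ} {es : List (ℕ × ℕ)} {Q : Data → ℕ → Prop}
    (hlt : ∀ x y, (x, y) ∈ es → y < n) (hsymm : ∀ x y, (x, y) ∈ es → (y, x) ∈ es)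
    (hL : 0 < L) (hW : L + n + n + n < W) (hhi : hi ≤ W)
    (hG : Searching n es col adj fin pend r) (h : SearchState L n hi m₀ col adj fin pend r σ)
    (hr : r < n)
    (hQ : ∀ σ' t' col' adj' fin' pend' r', Searching n es col' adj' fin' pend' r' →
      SearchState L n hi m₀ col' adj' fin' pend' r' σ' →
      t' + 2 + 20 * ∑ x ∈ Finset.range n, (adj' x).length +
          20 * (r + 2 * fin.length + pend.length) ≤ t + 20 * ∑ x ∈ Finset.range n, (adj x).length +
          20 * (r' + 2 * fin'.length + pend'.length) → Q σ' t') :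
    Wp W searchStep Q σ t := by
  have hlen := hG.length_le
  refine wp_ifEq (fun heq => ?_) fun hne => ?_
  · rw [h.reg4, h.reg5] at heq
    obtain rfl : pend = [] := List.eq_nil_of_length_eq_zero (by omega)
    simp only [wp_seq, wp_add, wp_load, Data.reg_setReg, Data.mem_setReg, ↓reduceIte,
      h.reg7, h.reg3, h.names r hr]
    refine ⟨by omega, wp_ifEq (fun h0 => ?_) fun h0 => ?_⟩ <;>
      simp only [Data.reg_setReg, Nat.reduceEqDiff, ↓reduceIte, h.reg11] at h0
    · have hG' := hG.start hr h0
      have := hG'.length_le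
      rw [List.length_singleton] at this
      refine ((h.setReg (.inl rfl)).setReg (.inr (.inl rfl))).visit (y := r) (by omega)
        (by simpa using h.reg3) hr (by simp) (by simp; omega) hr hW fun σ' h' => ?_
      refine hQ _ _ _ _ _ _ _ hG' h' ?_
      simp only [List.length_singleton, List.length_nil]
      omega
    · simp only [wp_add, Data.reg_setReg, Nat.reduceEqDiff, ↓reduceIte, h.reg3, h.reg2]
      refine ⟨by omega, hQ _ _ _ _ _ _ _ (hG.next hr h0) ?_ (by omega)⟩
      obtain ⟨h0, h1, h2, h3, h4, h5, h7, h11, hin, hn, hp, hl⟩ := h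
      constructor <;>
        simp only [Data.reg_setReg, Data.mem_setReg, Nat.reduceEqDiff, OfNat.zero_ne_ofNat,
          OfNat.one_ne_ofNat, ↓reduceIte] <;> assumption
  · obtain ⟨x, pend, rfl⟩ : ∃ x l, pend = x :: l := by
      cases pend with
      | nil => simp [h.reg4, h.reg5] at hne
      | cons x l => exact ⟨x, l, rfl⟩
    rw [List.length_cons] at *
    have hx : x < n := hG.lt x (by simp)
    simp only [wp_seq, wp_add, wp_load, Data.reg_setReg, Data.mem_setReg, OfNat.zero_ne_ofNat,
      ↓reduceIte, h.reg4, h.pending.1, h.reg0]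
    refine ⟨by omega, wp_ifEq (fun h0 => ?_) fun h0 => ?_⟩ <;>
      simp only [Data.reg_setReg, Nat.reduceEqDiff, ↓reduceIte, h.reg11] at h0
    -- Nodes lie at addresses at least `L + n + n + n`, which is positive, so a zero head can only
    -- mean the empty list.
    · have hadj : adj x = [] := by
        cases hl : adj x with
        | nil => rfl
        | cons y l =>
          have := (hl ▸ h.lists x hx).1
          omega
      simp only [wp_add, Data.reg_setReg, Nat.reduceEqDiff, ↓reduceIte,
        h.reg4, h.reg2]
      refine ⟨by omega, hQ _ _ _ _ _ _ _ (hG.pop hadj) ?_ ?_⟩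
      · obtain ⟨h0, h1, h2, h3, h4, h5, h7, h11, hin, hn, hp, hl⟩ := h
        constructor <;>
          simp only [Data.reg_setReg, Data.mem_setReg, Nat.reduceEqDiff, OfNat.zero_ne_ofNat,
            OfNat.one_ne_ofNat, ↓reduceIte, List.length_append, List.length_singleton]
        any_goals assumption
        · omega
        · rw [h5, List.length_cons]
          omega
        · exact hp.2
      · simp only [List.length_append, List.length_singleton]
        omega
    · obtain ⟨y, l, hadj⟩ : ∃ y l, adj x = y :: l := by
        cases hl : adj x with
        | nil => exact (h0 (by simpa [hl, Chain] using h.lists x hx)).elim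
        | cons y l => exact ⟨y, l, rfl⟩
      obtain ⟨ha, ha', hy, hl⟩ := hadj ▸ h.lists x hx
      have hyn : y < n := hlt x y (hG.unused x y (by simp [hadj]))
      have hsum := sum_length_update hx adj l
      rw [hadj, List.length_cons] at hsum
      generalize σ.mem (L + x) = a at *
      simp only [wp_seq, wp_add, wp_load, wp_store, Data.reg_setReg, Data.mem_setReg,
        Data.reg_setMem, Data.mem_setMem, Nat.reduceEqDiff, ↓reduceIte, hy, h.reg2, h.reg7]
      rw [Function.update_of_ne (by omega), h.names y hyn]
      refine ⟨by omega, by omega, ?_⟩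
      have h' : SearchState L n hi m₀ col (Function.update adj x l) fin (x :: pend) r
          (σ.setMem (L + x) (σ.mem (a + 1))) := by
        have hm : ∀ c, c ≠ L + x → Function.update σ.mem (L + x) (σ.mem (a + 1)) c = σ.mem c :=
          fun c hc => Function.update_of_ne hc ..
        obtain ⟨h0, h1, h2, h3, h4, h5, h7, h11, hin, hn, hp, hl'⟩ := h
        constructor <;> simp only [Data.reg_setMem, Data.mem_setMem]
        any_goals assumption
        · intro c hc
          rw [hm c (by omega), hin c hc]
        · intro z hz
          rw [hm _ (by omega), hn z hz]
        · exact hp.congr fun b hb hb' => hm b (by omega)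
        · intro z hz
          by_cases hzx : z = x
          · subst hzx
            rw [Function.update_self, Function.update_self]
            exact hl.congr (fun b hb hb' => hm b (by omega)) le_rfl
          · rw [hm _ (by omega), Function.update_of_ne hzx]
            exact (hl' z hz).congr (fun b hb hb' => hm b (by omega)) le_rfl
      -- The memory write is moved before the register writes, all eight of which hit only the
      -- scratch registers 10, 12 and 13.
      simp only [Data.setMem_setReg]
      have h'' {v₁ v₂ v₃ v₄ v₅ v₆ v₇ v₈} :=
        h'.setReg (v := v₁) (.inl rfl) |>.setReg (v := v₂) (.inl rfl)
          |>.setReg (v := v₃) (.inr (.inl rfl)) |>.setReg (v := v₄) (.inr (.inr rfl))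
          |>.setReg (v := v₅) (.inr (.inl rfl)) |>.setReg (v := v₆) (.inr (.inl rfl))
          |>.setReg (v := v₇) (.inl rfl) |>.setReg (v := v₈) (.inr (.inl rfl))
      refine wp_ifEq (fun h0 => ?_) fun h0 => ?_ <;>
        simp only [Data.reg_setReg, Data.reg_setMem, Nat.reduceEqDiff, ↓reduceIte, h.reg11] at h0
      · have hG' := hG.visit_new hlt hadj h0
        have hlen' := hG'.length_le
        rw [List.length_append, List.length_cons, List.length_singleton] at hlen'
        refine h''.visit (y := y) (by omega) (by simp) hyn (by simp)
          (by rw [List.length_cons]; omega) hr hW fun σ' h' => hQ _ _ _ _ _ _ _ hG' h' ?_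
        rw [List.length_append, List.length_cons, List.length_singleton]
        omega
      · rw [wp_skip]
        refine hQ _ _ _ _ _ _ _ (hG.visit_found hlt hsymm hadj h0) h'' ?_
        rw [List.length_cons]
        omega

/-- Behind the `L` input cells come three blocks of `n` cells (list heads, names, queue) and then
the list nodes. Since `r ≤ n` and `fin.length + pend.length ≤ n`, the potential grows by at most `3
* n + es.length` in total, which gives the linear bound. -/
theorem wp_search {W L n : ℕ} {es : List (ℕ × ℕ)} {Q : Data → ℕ → Prop} {σ : Data} {t : ℕ}
    (hlt : ∀ x y, (x, y) ∈ es → y < n) (hsymm : ∀ x y, (x, y) ∈ es → (y, x) ∈ es)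
    (hσ : Linked L n (L + n + n + n) es σ) (hL : 0 < L) (hW : L + n + n + n + 2 * es.length < W)
    (hQ : ∀ σ' t' (col : ℕ → ℕ), σ'.reg 1 = n → σ'.reg 2 = 1 → σ'.reg 7 = L + n → σ'.reg 11 = 0 →
      (∀ a < L, σ'.mem a = σ.mem a) → (∀ x < n, σ'.mem (L + n + x) = col x) →
      (∀ x y, (x, y) ∈ es → col x = col y) →
      (∀ x < n, ∀ y < n, col x = col y → Relation.EqvGen (fun x y => (x, y) ∈ es) x y) →
      t' ≤ t + 4 + 60 * n + 20 * es.length → Q σ' t') : Wp W search Q σ t := by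
  obtain ⟨h0, h1, h2, h7, h9, h11, he, adj, hadj, hes, hlen⟩ := hσ
  simp only [search, wp_seq, wp_sub, wp_add, Data.reg_setReg, Nat.reduceEqDiff, OfNat.one_ne_ofNat,
    ↓reduceIte, h1, h2, h7]
  refine ⟨by omega, by omega, ?_⟩
  refine wp_whileNe (fun σ' t' => ∃ col adj fin pend r, Searching n es col adj fin pend r ∧
    SearchState L n (σ.reg 9) σ.mem col adj fin pend r σ' ∧
    t' + 20 * ∑ x ∈ Finset.range n, (adj x).length ≤
      t + 3 + 20 * (r + 2 * fin.length + pend.length + es.length))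
    (t + 3 + 60 * n + 20 * es.length) ?_ ?_ ?_ ?_
  · rintro σ' t' ⟨col, adj, fin, pend, r, hG, h, ht⟩
    have h₁ := hG.le
    have h₂ := hG.length_le
    omega
  · refine ⟨fun _ => 0, adj, [], [], 0, ⟨by omega, .inr rfl, by simp, by simp, by simp, by simp,
      by simp, fun x y hxy => .inl ((hes x y).2 hxy), fun x y => (hes x y).1, by simp, by simp⟩,
      ?_, by simp only [List.length_nil]; omega⟩
    constructor <;> simp only [Data.reg_setReg, Data.mem_setReg, Nat.reduceEqDiff,
      OfNat.one_ne_ofNat, OfNat.zero_ne_ofNat, ↓reduceIte, List.length_nil]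
    any_goals first | assumption | omega | trivial
    · simp
    -- Blank memory is the initial naming: zero means not found.
    · exact fun x hx => he _ (by omega) (by omega)
  · rintro σ' t' ⟨col, adj, fin, pend, r, hG, h, ht⟩ hne
    have hr : r < n := lt_of_le_of_ne hG.le (by rwa [h.reg3, h.reg1] at hne)
    refine wp_searchStep hlt hsymm hL (by omega) (by omega) hG h hr ?_
    intro σ' t' col' adj' fin' pend' r' hG' h' ht'
    exact ⟨col', adj', fin', pend', r', hG', h', by omega⟩
  · rintro σ' t' ⟨col, adj, fin, pend, r, hG, h, ht⟩ heq
    obtain rfl : r = n := by rw [← h.reg3, heq, h.reg1]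
    have h₂ := hG.length_le
    exact hQ _ _ col h.reg1 h.reg2 h.reg7 h.reg11 h.input h.names (fun x y hxy =>
      hG.eq_of_mem (fun x y hxy => hlt y x (hsymm x y hxy)) hxy)
      (fun x hx y hy => hG.eqvGen_of_eq hx hy) (by omega)

end WordRAM

/-! ### Perfect coalition structures -/

/-- Indifferences are resolved by the positions in an arbitrary enumeration of the finite type. -/
theorem exists_resolves {A : Type} [Finite A] {r : A → A → Prop} (total : ∀ x y, r x y ∨ r y x)
    (trans : ∀ x y z, r x y → r y z → r x z) : ∃ s, Resolves r s := by
  obtain ⟨k, ⟨e⟩⟩ := Finite.exists_equiv_fin A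
  refine ⟨fun x y => r x y ∧ (r y x → e x < e y), @IsStrictTotalOrder.mk _ _ ?_ ?_,
    fun x y h h' => ⟨h, fun h => (h' h).elim⟩⟩
  · exact
      { trichotomous := fun x y h h' => by
          rcases total x y with hxy | hxy
          · by_cases hyx : r y x
            · have h₁ : ¬ e x < e y := fun he => h ⟨hxy, fun _ => he⟩
              have h₂ : ¬ e y < e x := fun he => h' ⟨hyx, fun _ => he⟩
              exact e.injective (le_antisymm (not_lt.1 h₂) (not_lt.1 h₁))
            · exact (h ⟨hxy, fun h => (hyx h).elim⟩).elim
          · by_cases hyx : r x y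
            · have h₁ : ¬ e x < e y := fun he => h ⟨hyx, fun _ => he⟩
              have h₂ : ¬ e y < e x := fun he => h' ⟨hxy, fun _ => he⟩
              exact e.injective (le_antisymm (not_lt.1 h₂) (not_lt.1 h₁))
            · exact (h' ⟨hxy, fun h => (hyx h).elim⟩).elim }
  · exact
      { irrefl := fun x h => lt_irrefl _ (h.2 h.1)
        trans := fun x y z h h' => ⟨trans _ _ _ h.1 h'.1, fun hz =>
          (h.2 (trans _ _ _ h'.1 hz)).trans (h'.2 (trans _ _ _ hz h.1))⟩ }

theorem kendallTau_self {A : Type} {s : A → A → Prop} (hs : IsStrictTotalOrder A s) :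
    kendallTau s s = 0 := by
  have : {p : A × A | s p.1 p.2 ∧ s p.2 p.1} = ∅ :=
    Set.eq_empty_of_forall_notMem fun p hp => hs.irrefl _ (hs.trans _ _ _ hp.1 hp.2)
  rw [kendallTau, this, Set.ncard_empty]

/-- Each `b` can be answered by itself. No resolution needs to exist, since an empty supremum of
natural numbers is zero. -/
theorem directedDist_self {A : Type} (r : A → A → Prop) : directedDist r r = 0 := by
  refine Nat.le_zero.1 (ciSup_le' fun b => ?_)
  exact (ciInf_le' _ b).trans (kendallTau_self b.2.1).le

/-- A pair ranked strictly and oppositely is counted for every choice of resolutions. Existence of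
resolutions and finiteness rule out the default value zero of an empty infimum and of an empty or
unbounded supremum. -/
theorem directedDist_pos {A : Type} [Finite A] {r₁ r₂ : A → A → Prop} (h₁ : ∃ s, Resolves r₁ s)
    (h₂ : ∃ s, Resolves r₂ s) {x y : A} (hxy : r₁ x y ∧ ¬ r₁ y x) (hyx : r₂ y x ∧ ¬ r₂ x y) :
    0 < directedDist r₁ r₂ := by
  obtain ⟨b, hb⟩ := h₂
  have hle : ∀ s t : A → A → Prop, kendallTau s t ≤ Nat.card (A × A) := fun s t =>
    Set.ncard_le_card _
  have : Nonempty {s : A → A → Prop // Resolves r₁ s} := let ⟨a, ha⟩ := h₁; ⟨⟨a, ha⟩⟩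
  refine lt_of_lt_of_le ?_ (le_ciSup (f := fun b : {s : A → A → Prop // Resolves r₂ s} =>
    ⨅ a : {s : A → A → Prop // Resolves r₁ s}, kendallTau a.1 b.1)
    ⟨Nat.card (A × A), ?_⟩ ⟨b, hb⟩)
  · refine Nat.lt_of_succ_le (le_ciInf fun a => ?_)
    exact (Set.ncard_pos (Set.toFinite _)).2 ⟨(x, y), a.2.2 _ _ hxy.1 hxy.2, hb.2 _ _ hyx.1 hyx.2⟩
  · rintro _ ⟨b, rfl⟩
    exact (ciInf_le' _ (Classical.arbitrary _)).trans (hle _ _)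

/-! ### Distance zero and perfection -/

namespace HedonicGame

variable {n : ℕ}

theorem exists_resolves_ballot {i : Fin n} {S P Q : Finset (Fin n)} {r r' : Fin n → Fin n → Prop}
    (hS : ∀ x, x ∈ S ↔ x ∈ P ∨ x ∈ Q) (hi : i ∉ S) (hPQ : Disjoint P Q)
    (hr : IsWeakOrderOn S r) (hr' : IsWeakOrderOn S r') :
    ∃ s, Resolves (restrict (insert i S) (ballot i P r Q r')) s := by
  have hPQ' : ∀ x, x ∈ P → x ∉ Q := fun x hx hx' => Finset.disjoint_left.1 hPQ hx hx'
  have hi' : i ∉ P ∧ i ∉ Q := by rw [hS] at hi; tauto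
  apply exists_resolves
  · rintro ⟨x, hx⟩ ⟨y, hy⟩
    have h₁ := hr.1 x
    have h₂ := hr'.1 x
    simp only [Finset.mem_insert, hS] at hx hy h₁ h₂
    have h₁ := fun h => h₁ h y
    have h₂ := fun h => h₂ h y
    simp only [restrict, ballot]
    grind
  · rintro ⟨x, hx⟩ ⟨y, hy⟩ ⟨z, hz⟩ hxy hyz
    have h₁ := fun h => hr.2 x h y
    have h₂ := fun h => hr'.2 x h y
    simp only [Finset.mem_insert, hS] at hx hy hz h₁ h₂
    have h₁ := fun h h' => h₁ h h' z
    have h₂ := fun h h' => h₂ h h' z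
    simp only [restrict, ballot] at hxy hyz ⊢
    grind

theorem _root_.IsWeakOrderOn.swap {A : Type} {S : Finset A} {r : A → A → Prop}
    (h : IsWeakOrderOn S r) : IsWeakOrderOn S fun x y => r y x :=
  ⟨fun x hx y hy => h.1 y hy x hx, fun x hx y hy z hz hxy hyz => h.2 z hz y hy x hx hyz hxy⟩

/-- An absent friend is above `i` in the opinion and below `i` in the ballot, a strict disagreement.
With all friends present, ballot and opinion are the same relation. -/
theorem deltaPlus_eq_zero_iff (G : HedonicGame n) (i : Fin n) (C : Finset (Fin n)) :
    G.deltaPlus i C = 0 ↔ G.friends i ⊆ C := by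
  constructor
  · intro h j hj
    by_contra hC
    have hij : j ≠ i := fun h => G.self_notMem_friends i (h ▸ hj)
    refine (directedDist_pos (x := ⟨j, Finset.mem_insert_of_mem hj⟩)
      (y := ⟨i, Finset.mem_insert_self _ _⟩) ?_ ?_ ?_ ?_).ne' h
    · exact exists_resolves_ballot (by simp) (G.self_notMem_friends i) (by simp)
        (G.friendPref_weak i) (G.friendPref_weak i)
    · exact exists_resolves_ballot (by simp; tauto) (G.self_notMem_friends i)
        (Finset.disjoint_left.2 (by simp +contextual)) (G.friendPref_weak i)
        (G.friendPref_weak i).swap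
    · simp [restrict, prefPlus, ballot, hj, hij, G.self_notMem_friends]
    · simp [restrict, coalPlus, ballot, hj, hij, hC, G.self_notMem_friends]
  · intro h
    have h₁ : C ∩ G.friends i = G.friends i := Finset.inter_eq_right.2 h
    have h₂ : G.friends i \ C = ∅ := Finset.sdiff_eq_empty_iff_subset.2 h
    have : G.coalPlus i C = G.prefPlus i := by
      ext x y; simp [coalPlus, prefPlus, h₁, h₂, ballot]
    rw [deltaPlus, this, directedDist_self]

/-- Here a present enemy is the player on the wrong side of `i`. -/
theorem deltaMinus_eq_zero_iff (G : HedonicGame n) (i : Fin n) (C : Finset (Fin n)) :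
    G.deltaMinus i C = 0 ↔ Disjoint (G.enemies i) C := by
  constructor
  · refine fun h => Finset.disjoint_left.2 fun j hj hC => ?_
    have hij : j ≠ i := fun h => G.self_notMem_enemies i (h ▸ hj)
    refine (directedDist_pos (y := ⟨j, Finset.mem_insert_of_mem hj⟩)
      (x := ⟨i, Finset.mem_insert_self _ _⟩) ?_ ?_ ?_ ?_).ne' h
    · exact exists_resolves_ballot (by simp) (G.self_notMem_enemies i) (by simp)
        (G.enemyPref_weak i) (G.enemyPref_weak i)
    · exact exists_resolves_ballot (by simp; tauto) (G.self_notMem_enemies i)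
        (Finset.disjoint_left.2 (by simp +contextual)) (G.enemyPref_weak i).swap
        (G.enemyPref_weak i)
    · simp [restrict, prefMinus, ballot, hj, hij, G.self_notMem_enemies]
    · simp [restrict, coalMinus, ballot, hj, hij, hC, G.self_notMem_enemies]
  · intro h
    have h₁ : C ∩ G.enemies i = ∅ := Finset.disjoint_iff_inter_eq_empty.1 h.symm
    have h₂ : G.enemies i \ C = G.enemies i := Finset.sdiff_eq_self_of_disjoint h
    have : G.coalMinus i C = G.prefMinus i := by
      ext x y; simp [coalMinus, prefMinus, h₁, h₂, ballot]
    rw [deltaMinus, this, directedDist_self]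

/-- A coalition structure is perfect iff everybody is together with all friends and with no
enemy. -/
theorem isPerfect_iff (G : HedonicGame n) (Γ : Finpartition (Finset.univ : Finset (Fin n))) :
    G.IsPerfect Γ ↔ ∀ i, (∀ j ∈ G.friends i, j ∈ Γ.part i) ∧ ∀ j ∈ G.enemies i, j ∉ Γ.part i := by
  have key : ∀ i C, G.delta i C = 0 ↔ (∀ j ∈ G.friends i, j ∈ C) ∧ ∀ j ∈ G.enemies i, j ∉ C :=
    fun i C => by
      rw [delta, Nat.add_eq_zero_iff, deltaPlus_eq_zero_iff, deltaMinus_eq_zero_iff,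
        Finset.disjoint_left]
      rfl
  refine forall_congr' fun i => ⟨fun h => (key i _).1 (Nat.le_zero.1 ?_), fun h C _ => ?_⟩
  -- The coalition of `i` and the friends contains no enemy, so it has distance zero and forces the
  -- same on a favourite coalition.
  · refine (h (insert i (G.friends i)) (Finset.mem_insert_self _ _)).trans
      ((key i _).2 ⟨fun j hj => Finset.mem_insert_of_mem hj, fun j hj hj' => ?_⟩).le
    rcases Finset.mem_insert.1 hj' with rfl | hj'
    · exact G.self_notMem_enemies _ hj
    · exact Finset.disjoint_left.1 (G.disjoint i) hj' hj
  · rw [WeaklyPrefers, (key i _).2 h]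
    exact Nat.zero_le _

end HedonicGame

/-! ### Encoded games as lists of numbers -/

namespace HedonicGame

open WordRAM

variable {n : ℕ}

/-- A family of ranked lists of players, with the players as numbers. -/
def natLists (F : Fin n → List (Fin n × ℕ)) (i : ℕ) : List (ℕ × ℕ) :=
  if h : i < n then (F ⟨i, h⟩).map fun p => (p.1.val, p.2) else []

theorem natLists_val (F : Fin n → List (Fin n × ℕ)) (i : Fin n) :
    natLists F i = (F i).map fun p => (p.1.val, p.2) := by
  simp [natLists]

theorem rankedCode_natLists (F : Fin n → List (Fin n × ℕ)) (i : Fin n) :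
    rankedCode (natLists F i) = encodeRanked (F i) := by
  simp [natLists_val, rankedCode, encodeRanked, List.flatMap_map]

theorem mem_natLists {F : Fin n → List (Fin n × ℕ)} {S : Fin n → Finset (Fin n)}
    {r : Fin n → Fin n → Fin n → Prop} (hF : ∀ i, ListsRanked (S i) (r i) (F i)) {i j : ℕ} :
    j ∈ (natLists F i).map Prod.fst ↔ ∃ (hi : i < n) (hj : j < n), ⟨j, hj⟩ ∈ S ⟨i, hi⟩ := by
  by_cases hi : i < n
  · lift i to Fin n using hi
    simp only [natLists_val, List.map_map, Fin.eta, ← (hF i).2.1, List.mem_map, Fin.is_lt,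
      exists_true_left, Function.comp_apply]
    constructor
    · rintro ⟨p, hp, rfl⟩
      exact ⟨p.1.2, p, hp, rfl⟩
    · rintro ⟨hj, p, hp, hpj⟩
      exact ⟨p, hp, by rw [hpj]⟩
  · simp [natLists, hi]

theorem length_natLists {F : Fin n → List (Fin n × ℕ)} {S : Fin n → Finset (Fin n)}
    {r : Fin n → Fin n → Fin n → Prop} (hF : ∀ i, ListsRanked (S i) (r i) (F i)) (i : Fin n) :
    (natLists F i).length = (S i).card := by
  classical
  obtain ⟨hnodup, hmem, -⟩ := hF i
  have : S i = ((F i).map Prod.fst).toFinset := by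
    ext j
    rw [List.mem_toFinset, hmem]
  rw [this, List.toFinset_card_of_nodup hnodup, natLists_val, List.length_map, List.length_map]

theorem length_flatMap_range_le {A : Type} (n b : ℕ) (f : ℕ → List A)
    (h : ∀ i < n, (f i).length ≤ b) : ((List.range n).flatMap f).length ≤ b * n := by
  induction n with
  | zero => simp
  | succ n ih =>
    have h₁ := ih fun i hi => h i (by omega)
    have h₂ := h n (by omega)
    simp only [List.range_succ, List.flatMap_append, List.length_append, List.flatMap_cons,
      List.flatMap_nil, List.append_nil, Nat.mul_succ]
    omega

/-- The properties of an encoded game in terms of lists of numbers. -/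
structure IsCode (G : HedonicGame n) (d : ℕ) (F E : ℕ → List (ℕ × ℕ)) : Prop where
  friend : ∀ i j, (true, i, j) ∈ entries n F E ↔
    ∃ (hi : i < n) (hj : j < n), ⟨j, hj⟩ ∈ G.friends ⟨i, hi⟩
  enemy : ∀ i j, (false, i, j) ∈ entries n F E ↔
    ∃ (hi : i < n) (hj : j < n), ⟨j, hj⟩ ∈ G.enemies ⟨i, hi⟩
  length_entries : (entries n F E).length ≤ d * n
  length_code : (gameCode n F E).length ≤ 1 + (2 * d + 2) * n
  le : ∀ a ∈ gameCode n F E, a ≤ d + n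

/-- The degree bound enters the size estimates here: friends and enemies are disjoint, so the two
lists of a player have at most `d` entries together. With two cells per entry and one for each
length, a player takes at most `2 * d + 2` cells. -/
theorem Encodes.exists_isCode {G : HedonicGame n} {d : ℕ} {u : List ℕ} (hd : G.DegreeLE d)
    (hu : G.Encodes u) : ∃ F E : ℕ → List (ℕ × ℕ), u = gameCode n F E ∧ G.IsCode d F E := by
  obtain ⟨F, E, hF, hE, rfl⟩ := hu
  have hlen : ∀ i < n, (natLists F i).length + (natLists E i).length ≤ d := fun i hi => by
    lift i to Fin n using hi
    rw [length_natLists hF, length_natLists hE, ← Finset.card_union_of_disjoint (G.disjoint i)]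
    exact hd i
  have hmem : ∀ b i j, (b, i, j) ∈ entries n (natLists F) (natLists E) ↔
      i < n ∧ j ∈ ((if b then natLists F i else natLists E i).map Prod.fst) := by
    intro b i j
    cases b <;> simp [entries, playerEntries]
  refine ⟨natLists F, natLists E, ?_, fun i j => ?_, fun i j => ?_, ?_, ?_, ?_⟩
  · rw [gameCode, ← List.map_coe_finRange_eq_range, List.flatMap_map]
    simp only [rankedCode_natLists]
  · rw [hmem, if_pos rfl, mem_natLists hF]
    exact ⟨fun h => h.2, fun h => ⟨h.1, h⟩⟩
  · rw [hmem, if_neg (by simp), mem_natLists hE]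
    exact ⟨fun h => h.2, fun h => ⟨h.1, h⟩⟩
  · refine length_flatMap_range_le _ _ _ fun i hi => ?_
    simpa [playerEntries] using hlen i hi
  · rw [gameCode, List.length_cons, Nat.add_comm]
    refine Nat.add_le_add_left (length_flatMap_range_le _ _ _ fun i hi => ?_) _
    have := hlen i hi
    simp only [List.length_append, length_rankedCode]
    omega
  · have hlist : ∀ (F : Fin n → List (Fin n × ℕ)) (S : Fin n → Finset (Fin n))
        (r : Fin n → Fin n → Fin n → Prop), (∀ i, ListsRanked (S i) (r i) (F i)) →
        ∀ i : Fin n, (natLists F i).length ≤ d → ∀ a ∈ rankedCode (natLists F i), a ≤ d + n := by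
      intro F S r hF i hi a ha
      rw [natLists_val] at hi ha
      simp only [rankedCode, List.mem_cons, List.mem_flatMap, List.mem_map,
        List.not_mem_nil, or_false] at ha
      rcases ha with rfl | ⟨_, ⟨p, hp, rfl⟩, rfl | rfl⟩
      · omega
      · have := p.1.2
        omega
      · have := (hF i).2.2.1 p hp
        simp only
        omega
    intro a ha
    simp only [gameCode, List.mem_cons, List.mem_flatMap, List.mem_range, List.mem_append] at ha
    rcases ha with rfl | ⟨i, hi, ha⟩
    · omega
    · have := hlen i hi
      lift i to Fin n using hi
      rcases ha with ha | ha
      · exact hlist F _ _ hF i (by omega) a ha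
      · exact hlist E _ _ hE i (by omega) a ha

namespace IsCode

variable {G : HedonicGame n} {d : ℕ} {F E : ℕ → List (ℕ × ℕ)}

theorem lt (h : G.IsCode d F E) : ∀ e ∈ entries n F E, e.2.1 < n ∧ e.2.2 < n := by
  rintro ⟨_ | _, i, j⟩ he
  · obtain ⟨hi, hj, -⟩ := (h.enemy i j).1 he
    exact ⟨hi, hj⟩
  · obtain ⟨hi, hj, -⟩ := (h.friend i j).1 he
    exact ⟨hi, hj⟩

theorem forall_fits_iff (h : G.IsCode d F E) (g : ℕ → ℕ) :
    (∀ e ∈ entries n F E, Fits g e) ↔ ∀ i : Fin n, (∀ j ∈ G.friends i, g i = g j) ∧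
      ∀ j ∈ G.enemies i, g i ≠ g j := by
  constructor
  · refine fun hg i => ⟨fun j hj => ?_, fun j hj => ?_⟩
    · simpa [Fits] using hg (true, i, j) ((h.friend i j).2 ⟨i.2, j.2, hj⟩)
    · simpa [Fits] using hg (false, i, j) ((h.enemy i j).2 ⟨i.2, j.2, hj⟩)
  · rintro hg ⟨_ | _, i, j⟩ he
    · obtain ⟨hi, hj, he⟩ := (h.enemy i j).1 he
      simpa [Fits] using (hg ⟨i, hi⟩).2 _ he
    · obtain ⟨hi, hj, he⟩ := (h.friend i j).1 he
      simpa [Fits] using (hg ⟨i, hi⟩).1 _ he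

theorem mem_edges_lt (h : G.IsCode d F E) {x y : ℕ} (hxy : (x, y) ∈ edges (entries n F E)) :
    x < n ∧ y < n := by
  rcases mem_edges.1 hxy with hxy | hxy
  · exact h.lt _ hxy
  · exact (h.lt _ hxy).symm

/-- The names of the connected components of the friendship graph fit iff there is a perfect
coalition structure. -/
theorem forall_fits_iff_exists_isPerfect (h : G.IsCode d F E) {col : ℕ → ℕ}
    (heq : ∀ x y, (x, y) ∈ edges (entries n F E) → col x = col y)
    (hreach : ∀ x < n, ∀ y < n, col x = col y →
      Relation.EqvGen (fun x y => (x, y) ∈ edges (entries n F E)) x y) :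
    (∀ e ∈ entries n F E, Fits col e) ↔
      ∃ Γ : Finpartition (Finset.univ : Finset (Fin n)), G.IsPerfect Γ := by
  classical
  rw [h.forall_fits_iff]
  constructor
  · intro hfit
    refine ⟨Finpartition.ofSetoid (Setoid.ker fun i : Fin n => col i), G.isPerfect_iff _ |>.2 ?_⟩
    simpa only [Finpartition.mem_part_ofSetoid_iff_rel, Setoid.ker_def] using hfit
  · rintro ⟨Γ, hΓ⟩ i
    rw [isPerfect_iff] at hΓ
    refine ⟨fun j hj => heq i j (mem_edges.2 (.inl ((h.friend i j).2 ⟨i.2, j.2, hj⟩))),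
      fun j hj hij => (hΓ i).2 j hj ?_⟩
    -- The coalition in `Γ`, as a function on vertex numbers, is constant along friendship edges and
    -- hence on components. Two enemies with the same name would share a coalition.
    let p : ℕ → Finset (Fin n) := fun x => if hx : x < n then Γ.part ⟨x, hx⟩ else ∅
    have hedge : ∀ x y, (true, x, y) ∈ entries n F E → p x = p y := by
      intro x y hxy
      obtain ⟨hx, hy, hxy⟩ := (h.friend x y).1 hxy
      simp only [p, hx, hy, dite_true]
      exact (Γ.part_eq_of_mem (Γ.part_mem.2 (Finset.mem_univ _)) ((hΓ _).1 _ hxy)).symm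
    have hp : ∀ x y, Relation.EqvGen (fun x y => (x, y) ∈ edges (entries n F E)) x y →
        p x = p y := by
      intro x y hxy
      induction hxy with
      | rel x y hxy =>
        rcases mem_edges.1 hxy with hxy | hxy
        · exact hedge x y hxy
        · exact (hedge y x hxy).symm
      | refl => rfl
      | symm _ _ _ ih => exact ih.symm
      | trans _ _ _ _ _ ih ih' => exact ih.trans ih'
    have := hp i j (hreach i i.2 j j.2 hij)
    simp only [p, Fin.is_lt, dite_true, Fin.eta] at this
    rw [this]
    exact Γ.mem_part (Finset.mem_univ _)

end IsCode

/-! ### The two decision programs -/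

/-- Check whether a coalition structure, given behind a game, is perfect. -/
def checkStructure : Cmd := .load 1 11 ;; .const 2 1 ;; .sub 7 0 1 ;; check

/-- Check whether there is a perfect coalition structure. -/
def checkExists : Cmd :=
  .load 1 11 ;; .const 2 1 ;; .add 7 0 1 ;; .add 9 7 1 ;; .add 9 9 1 ;; build ;; search ;; check

/-- Register 0 holds the total input length and the last `n` cells are the names, so subtracting `n`
gives their address. The test of the names then decides the characterization of perfection directly.
-/
theorem answersWithin_checkStructure {d : ℕ} {G : HedonicGame n}
    {Γ : Finpartition (Finset.univ : Finset (Fin n))} {u v : List ℕ} (hd : G.DegreeLE d)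
    (hu : G.Encodes u) (hv : EncodesStructure Γ v) :
    ∃ b : Bool, AnswersWithin (checkStructure.program 8 11) (u ++ v) ((100 * d + 100) * (n + 1))
      ((100 * d + 100) * (n + 1)) b ∧ (b = true ↔ G.IsPerfect Γ) := by
  obtain ⟨F, E, rfl, h⟩ := hu.exists_isCode hd
  obtain ⟨g, hg, rfl⟩ := hv
  have h₁ := h.length_code
  have h₂ := h.length_entries
  have hc : (100 * d + 100) * (n + 1) = 100 * (d * n) + 100 * d + 100 * n + 100 := by ring
  rw [Nat.add_mul, Nat.mul_assoc] at h₁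
  refine answersWithin_program ?_ ?_ ?_
  · rw [List.length_append, List.length_map, List.length_finRange]
    omega
  · intro a ha
    rcases List.mem_append.1 ha with ha | ha
    · have := h.le a ha
      omega
    · obtain ⟨i, -, rfl⟩ := List.mem_map.1 ha
      have := (g i).2
      omega
  · have hn : (gameCode n F E ++ (List.finRange n).map fun i => (g i).val).getD 0 0 = n := rfl
    simp only [checkStructure, wp_seq, wp_load, wp_const, wp_sub, Data.reg_setReg, init,
      OfNat.ofNat_ne_zero, OfNat.zero_ne_ofNat, OfNat.one_ne_ofNat,
      zero_ne_one, ↓reduceIte, hn, List.length_append, List.length_map, List.length_finRange,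
      Nat.add_sub_cancel]
    refine ⟨by omega, ?_⟩
    have hgame := reads_getD [] (gameCode n F E) ((List.finRange n).map fun i => (g i).val)
    refine wp_check (g := fun i => if hi : i < n then (g ⟨i, hi⟩).val else 0) h.lt
      hgame rfl le_rfl (by omega) ?_ ?_ ?_ ?_ ?_ ?_
    any_goals simp only [Data.reg_setReg, Data.mem_setReg, Nat.reduceEqDiff, OfNat.one_ne_ofNat,
      OfNat.ofNat_ne_zero, ↓reduceIte]
    · intro i hi
      rw [List.getD_eq_getElem?_getD, List.getElem?_append_right (by omega)]
      simp [hi]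
    · intro σ t h11 h8 ht
      rw [h11, h8]
      refine ⟨by omega, ?_⟩
      rw [h.forall_fits_iff, isPerfect_iff]
      simp [← hg, Fin.val_inj]

/-- Building, searching and checking each take time linear in `n` and the number of entries, where
the graph has at most two directed edges per entry. The generous factor `100 * d + 100` covers the
sum of their costs as well as all addresses in use. -/
theorem answersWithin_checkExists {d : ℕ} {G : HedonicGame n} {u : List ℕ} (hd : G.DegreeLE d)
    (hu : G.Encodes u) :
    ∃ b : Bool, AnswersWithin (checkExists.program 8 11) u ((100 * d + 100) * (n + 1))
      ((100 * d + 100) * (n + 1)) b ∧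
      (b = true ↔ ∃ Γ : Finpartition (Finset.univ : Finset (Fin n)), G.IsPerfect Γ) := by
  obtain ⟨F, E, rfl, h⟩ := hu.exists_isCode hd
  have h₁ := h.length_code
  have h₂ := h.length_entries
  have h₃ := length_edges_le (entries n F E)
  have hc : (100 * d + 100) * (n + 1) = 100 * (d * n) + 100 * d + 100 * n + 100 := by ring
  rw [Nat.add_mul, Nat.mul_assoc] at h₁
  refine answersWithin_program (by omega) (fun a ha => ?_) ?_
  · have := h.le a ha
    omega
  · have hn : (gameCode n F E).getD 0 0 = n := rfl
    have hL : 0 < (gameCode n F E).length := Nat.succ_pos _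
    simp only [checkExists, wp_seq, wp_load, wp_const, wp_add, Data.reg_setReg, init,
      OfNat.ofNat_ne_zero, OfNat.zero_ne_ofNat, OfNat.one_ne_ofNat,
      zero_ne_one, ↓reduceIte, hn]
    refine ⟨by omega, by omega, by omega, by omega, ?_⟩
    have hempty : ∀ a, (gameCode n F E).length ≤ a → (gameCode n F E).getD a 0 = 0 :=
      fun a ha => List.getD_eq_default _ _ ha
    have hgame : Reads (fun a => (gameCode n F E).getD a 0) 0 (gameCode n F E) := by
      simpa using reads_getD [] (gameCode n F E) []
    generalize hL' : (gameCode n F E).length = L at *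
    refine wp_build (lo := L + n + n + n) (L := L) h.lt hgame hL' (by omega) (by omega) ?_ ?_
    · constructor
      any_goals simp
      · intro a ha _
        simpa using hempty a (by omega)
      · exact ⟨fun _ => [], fun x hx => by simpa [Chain] using hempty (L + x) (by omega), by simp, by simp⟩
    intro σ t hσ ht hm
    rw [wp_seq]
    refine wp_search (L := L) (fun x y hxy => (h.mem_edges_lt hxy).2)
      (fun x y hxy => mem_edges.2 (mem_edges.1 hxy).symm) hσ hL (by omega) ?_
    intro σ' t' col h1 h2 h7 h11 hm' hcol heq hreach ht'
    refine wp_check h.lt (L := L) (hgame.congr fun a _ ha => ?_) hL' (by omega) (by omega) h1 h2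
      h7 h11 hcol ?_
    · rw [hm' a (by omega), hm a (by omega)]
      rfl
    · intro σ'' t'' h11 h8 ht''
      rw [h11, h8]
      exact ⟨by omega, h.forall_fits_iff_exists_isPerfect heq hreach⟩

end HedonicGame

theorem mainTheorem7 :
    (∃ P : List WordRAM.Instr, ∀ d : ℕ, 0 < d → ∃ c : ℕ,
      ∀ (n : ℕ) (G : HedonicGame n) (Γ : Finpartition (Finset.univ : Finset (Fin n)))
        (u v : List ℕ),
        G.DegreeLE d → G.Encodes u → HedonicGame.EncodesStructure Γ v →
        ∃ b : Bool, WordRAM.AnswersWithin P (u ++ v) (c * (n + 1)) (c * (n + 1)) b ∧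
          (b = true ↔ G.IsPerfect Γ)) ∧
    (∃ P : List WordRAM.Instr, ∀ d : ℕ, 0 < d → ∃ c : ℕ,
      ∀ (n : ℕ) (G : HedonicGame n) (u : List ℕ),
        G.DegreeLE d → G.Encodes u →
        ∃ b : Bool, WordRAM.AnswersWithin P u (c * (n + 1)) (c * (n + 1)) b ∧
          (b = true ↔ ∃ Γ : Finpartition (Finset.univ : Finset (Fin n)), G.IsPerfect Γ)) :=
  ⟨⟨HedonicGame.checkStructure.program 8 11, fun d _ => ⟨100 * d + 100,
    fun _ _ _ _ _ hd hu hv => HedonicGame.answersWithin_checkStructure hd hu hv⟩⟩,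
  ⟨HedonicGame.checkExists.program 8 11, fun d _ => ⟨100 * d + 100,
    fun _ _ _ hd hu => HedonicGame.answersWithin_checkExists hd hu⟩⟩⟩
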